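/- Let $S,T$ be finite sets, $V=S\cup T$, $n=|V|$, let $E\subseteq S\times T$ be a set of directed edges with nonnegative costs $\{c_e:e\in E\}$, and let $\mathcal F$ be a family of subsets of $V$. The family $\mathcal F$ is \emph{$(S,T)$-crossing} if $X\cap Y,\,X\cup Y\in\mathcal F$ for all $X,Y\in\mathcal F$ with $X\cap Y\cap S\neq\emptyset$ and $T\setminus(X\cup Y)\neq\emptyset$. An edge $(s,t)$ \emph{covers} $X\subseteq V$ if $s\in X$ and $t\notin X$; an edge set $J$ \emph{covers} $\mathcal F$ if every $X\in\mathcal F$ is covered by some edge of $J$. Let $$\tau(\mathcal F)=\min\Big\{\sum_{e\in E}c_ex_e \;:\; \sum_{e\in E,\ e\text{ covers }X}x_e\ge 1\ \ \forall X\in\mathcal F,\quad x_e\ge 0\ \ \forall e\in E\Big\}.$$ The family $\mathcal F$ need not be given explicitly: an algorithm may query, at unit cost, for any set $J$ of directed edges on $V$ and any $u,v\in V$, the core (the inclusion-minimal member) of the family $\{X\in\mathcal F : X \text{ not covered by } J,\ u\in X\cap S,\ v\in T\setminus X\}$ and the core of its co-family (the family of the complements $V\setminus X$ of its members), or learn that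 this family is empty. Theorem. There are an absolute constant $K$ and an algorithm (a fixed program of a random access machine that adds, subtracts and compares numbers at unit cost and has access to the above queries) which, for every $S,T,E,c$ and every $(S,T)$-crossing $\mathcal F$ as above, halts after a number of steps bounded by a fixed polynomial in $n$ and, whenever $E$ covers $\mathcal F$, outputs an edge set $J\subseteq E$ that covers $\mathcal F$ and has cost $$\sum_{e\in J}c_e\;\le\; K\cdot\log|S\cup T|\cdot\tau(\mathcal F).$$ -/

import Mathlib

noncomputable section

namespace EdgeCover

/-! ### Set-families on the node set `Fin n` and their edge-covers -/

/-- A directed edge `e = (s, t)` covers (leaves) the node set `X` if it goes from `X` to the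
complement of `X`. -/
def Covers {n : ℕ} (e : Fin n × Fin n) (X : Finset (Fin n)) : Prop :=
  e.1 ∈ X ∧ e.2 ∉ X

/-- `J` is an edge-cover of `F` if every member of `F` is covered by some edge of `J`. -/
def IsEdgeCover {n : ℕ} (J : Finset (Fin n × Fin n)) (F : Set (Finset (Fin n))) : Prop :=
  ∀ X ∈ F, ∃ e ∈ J, Covers e X

/-- `X` and `Y` `(S,T)`-cross if `X ∩ Y ∩ S` and `T \ (X ∪ Y)` are both nonempty. -/
def STCross {n : ℕ} (S T X Y : Finset (Fin n)) : Prop :=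
  (X ∩ Y ∩ S).Nonempty ∧ (T \ (X ∪ Y)).Nonempty

/-- `F` is `(S,T)`-crossing if it contains the intersection and the union of any two of its
members that `(S,T)`-cross. -/
def IsSTCrossing {n : ℕ} (S T : Finset (Fin n)) (F : Set (Finset (Fin n))) : Prop :=
  ∀ X ∈ F, ∀ Y ∈ F, STCross S T X Y → X ∩ Y ∈ F ∧ X ∪ Y ∈ F

open Classical in
/-- `x` is a feasible solution of the linear programming relaxation of the problem of covering
`F` by edges of `E`. -/
def IsFractionalCover {n : ℕ} (E : Finset (Fin n × Fin n)) (F : Set (Finset (Fin n)))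
    (x : Fin n × Fin n → ℝ) : Prop :=
  (∀ X ∈ F, 1 ≤ ∑ e ∈ E with Covers e X, x e) ∧ ∀ e ∈ E, 0 ≤ x e

/-- `τ(F)`: the optimal value of the linear programming relaxation. -/
def lpValue {n : ℕ} (E : Finset (Fin n × Fin n)) (c : Fin n × Fin n → ℝ)
    (F : Set (Finset (Fin n))) : ℝ :=
  sInf {z | ∃ x, IsFractionalCover E F x ∧ z = ∑ e ∈ E, c e * x e}

/-! ### The queries to the family

The family is not part of the explicit input.  An algorithm accesses it by asking, for an edge
set `J` and nodes `u`, `v`, for the core of `F^J(u,v)` or for the core of its co-family. -/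

/-- `F^J(u,v)`: the members `X` of `F` that are not covered by `J` and satisfy `u ∈ X ∩ S` and
`v ∈ T \ X`. -/
def residual {n : ℕ} (S T : Finset (Fin n)) (F : Set (Finset (Fin n)))
    (J : Finset (Fin n × Fin n)) (u v : Fin n) : Set (Finset (Fin n)) :=
  {X | X ∈ F ∧ (∀ e ∈ J, ¬ Covers e X) ∧ u ∈ X ∩ S ∧ v ∈ T \ X}

/-- The co-family: the complements of the members. -/
def coFamily {n : ℕ} (G : Set (Finset (Fin n))) : Set (Finset (Fin n)) :=
  {Y | Yᶜ ∈ G}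

/-- A core of a family is an inclusion-minimal member. -/
def IsCore {n : ℕ} (G : Set (Finset (Fin n))) (C : Finset (Fin n)) : Prop :=
  Minimal (fun X => X ∈ G) C

open Classical in
/-- A core of `G`, or `none` if `G` is empty.  If `F` is `(S,T)`-crossing, then each family
`F^J(u,v)` and its co-family is closed under intersection, so there is at most one core and
nothing is chosen. -/
def core {n : ℕ} (G : Set (Finset (Fin n))) : Option (Finset (Fin n)) :=
  if h : ∃ C, IsCore G C then some h.choose else none

/-- If `F` is `(S,T)`-crossing, `F^J(u,v)` is closed under intersection and union. -/
theorem residual_closed {n : ℕ} {S T : Finset (Fin n)} {F : Set (Finset (Fin n))}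
    (hF : IsSTCrossing S T F) (J : Finset (Fin n × Fin n)) (u v : Fin n)
    {X Y : Finset (Fin n)} (hX : X ∈ residual S T F J u v) (hY : Y ∈ residual S T F J u v) :
    X ∩ Y ∈ residual S T F J u v ∧ X ∪ Y ∈ residual S T F J u v := by
  obtain ⟨hX1, hX2, hX3, hX4⟩ := hX
  obtain ⟨hY1, hY2, hY3, hY4⟩ := hY
  simp only [Finset.mem_inter, Finset.mem_sdiff] at hX3 hX4 hY3 hY4
  have h := hF X hX1 Y hY1 ⟨⟨u, by simp [hX3, hY3]⟩, ⟨v, by simp [hX4, hY4]⟩⟩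
  refine ⟨⟨h.1, ?_, by simp [hX3, hY3], by simp [hX4]⟩,
    ⟨h.2, ?_, by simp [hX3], by simp [hX4, hY4]⟩⟩
  · intro e he
    have := hX2 e he
    have := hY2 e he
    simp only [Covers, Finset.mem_inter] at *
    tauto
  · intro e he
    have := hX2 e he
    have := hY2 e he
    simp only [Covers, Finset.mem_union] at *
    tauto

/-- The core reported for `F^J(u,v)` is its least member. -/
theorem core_residual {n : ℕ} {S T : Finset (Fin n)} {F : Set (Finset (Fin n))}
    (hF : IsSTCrossing S T F) (J : Finset (Fin n × Fin n)) (u v : Fin n)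
    (C : Finset (Fin n)) :
    core (residual S T F J u v) = some C ↔ IsLeast (residual S T F J u v) C := by
  have key : ∀ D, IsCore (residual S T F J u v) D → IsLeast (residual S T F J u v) D :=
    fun D hD => ⟨hD.1, fun X hX =>
      (hD.2 (residual_closed hF J u v hD.1 hX).1 Finset.inter_subset_left).trans
        Finset.inter_subset_right⟩
  unfold core
  split_ifs with h
  · rw [Option.some_inj]
    have h' := key _ h.choose_spec
    exact ⟨fun e => e ▸ h', fun hC => h'.unique hC⟩
  · refine ⟨fun e => by simp at e, fun hC => (h ⟨C, hC.1, fun X hX _ => hC.2 hX⟩).elim⟩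

/-- The core reported for the co-family of `F^J(u,v)` is the complement of the greatest member
of `F^J(u,v)`. -/
theorem core_coFamily_residual {n : ℕ} {S T : Finset (Fin n)} {F : Set (Finset (Fin n))}
    (hF : IsSTCrossing S T F) (J : Finset (Fin n × Fin n)) (u v : Fin n)
    (C : Finset (Fin n)) :
    core (coFamily (residual S T F J u v)) = some C ↔
      IsGreatest (residual S T F J u v) Cᶜ := by
  have key : ∀ D, IsCore (coFamily (residual S T F J u v)) D →
      IsLeast (coFamily (residual S T F J u v)) D := fun D hD => ⟨hD.1, fun X hX => by
    have h1 : D ∩ X ∈ coFamily (residual S T F J u v) := by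
      have := (residual_closed hF J u v hD.1 hX).2
      rw [← Finset.compl_inter] at this
      exact this
    exact (hD.2 h1 Finset.inter_subset_left).trans Finset.inter_subset_right⟩
  have hgl : ∀ D, IsGreatest (residual S T F J u v) Dᶜ ↔
      IsLeast (coFamily (residual S T F J u v)) D := by
    intro D
    constructor
    · exact fun h => ⟨h.1, fun X hX => Finset.compl_subset_compl.1 (h.2 hX)⟩
    · intro h
      refine ⟨h.1, fun X hX => ?_⟩
      have h2 : Xᶜ ∈ coFamily (residual S T F J u v) := by
        simpa [coFamily] using hX
      have h3 := Finset.compl_subset_compl.2 (h.2 h2)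
      simpa using h3
  rw [hgl]
  unfold core
  split_ifs with h
  · rw [Option.some_inj]
    have h' := key _ h.choose_spec
    exact ⟨fun e => e ▸ h', fun hC => h'.unique hC⟩
  · refine ⟨fun e => by simp at e, fun hC => (h ⟨C, hC.1, fun X hX _ => hC.2 hX⟩).elim⟩

/-! ### The machine model

A random access machine with two sorts of data: natural numbers (for nodes, counters and bits)
and edge-costs.  Both can only be added, subtracted and compared, in one step each; there is no
multiplication, no conversion from one sort to the other and no constant cost other than `0`.
Hence a step lengthens the numbers in memory only by a number of bits that depends on the program
alone (for rational costs: of the numerators over the common denominator of the input), and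
polynomially many steps amount to polynomial time on a Turing machine as well.  A program is a
finite piece of syntax; it does not depend on the size of the instance. -/

/-- Memory: scalar variables and two-dimensional arrays of both sorts, named by numbers that are
written in the program. -/
structure State where
  reg : ℕ → ℕ
  arr : ℕ → ℕ → ℕ → ℕ
  costReg : ℕ → ℝ
  costArr : ℕ → ℕ → ℕ → ℝ

/-- Expressions of natural-number sort (`sub` is truncated subtraction). -/
inductive NatExpr where
  | const (k : ℕ)
  | reg (x : ℕ)
  | arr (a : ℕ) (i j : NatExpr)
  | add (e f : NatExpr)
  | sub (e f : NatExpr)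

/-- Expressions of cost sort. -/
inductive CostExpr where
  | zero
  | reg (x : ℕ)
  | arr (a : ℕ) (i j : NatExpr)
  | add (e f : CostExpr)
  | sub (e f : CostExpr)

/-- Tests. -/
inductive Test where
  | natLe (e f : NatExpr)
  | costLe (e f : CostExpr)
  | neg (b : Test)
  | and (b b' : Test)

/-- Programs. -/
inductive Program where
  | skip
  | setReg (x : ℕ) (e : NatExpr)
  | setArr (a : ℕ) (i j e : NatExpr)
  | setCostReg (x : ℕ) (e : CostExpr)
  | setCostArr (a : ℕ) (i j : NatExpr) (e : CostExpr)
  | seq (p q : Program)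
  | cond (b : Test) (p q : Program)
  | loop (b : Test) (p : Program)
  /-- Ask about the edge set stored as an adjacency matrix in the array `a` and the nodes `u`, `v`;
  `co` selects the co-family.  The variable `x` receives `1` if there is an answer and `0`
  otherwise; the answer is put into row `k` of the array `b`. -/
  | query (co : Bool) (a : ℕ) (u v : NatExpr) (x : ℕ) (b : ℕ) (k : NatExpr)

def NatExpr.eval (s : State) : NatExpr → ℕ
  | .const k => k
  | .reg x => s.reg x
  | .arr a i j => s.arr a (i.eval s) (j.eval s)
  | .add e f => e.eval s + f.eval s
  | .sub e f => e.eval s - f.eval s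

def CostExpr.eval (s : State) : CostExpr → ℝ
  | .zero => 0
  | .reg x => s.costReg x
  | .arr a i j => s.costArr a (i.eval s) (j.eval s)
  | .add e f => e.eval s + f.eval s
  | .sub e f => e.eval s - f.eval s

def Test.Holds (s : State) : Test → Prop
  | .natLe e f => e.eval s ≤ f.eval s
  | .costLe e f => e.eval s ≤ f.eval s
  | .neg b => ¬ b.Holds s
  | .and b b' => b.Holds s ∧ b'.Holds s

/-- Overwrite one entry of an array of either sort. -/
def updateEntry {α : Type} (m : ℕ → ℕ → ℕ → α) (a i j : ℕ) (z : α) : ℕ → ℕ → ℕ → α :=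
  Function.update m a (Function.update (m a) i (Function.update (m a i) j z))

/-- Overwrite one row of an array. -/
def updateRow (m : ℕ → ℕ → ℕ → ℕ) (a i : ℕ) (z : ℕ → ℕ) : ℕ → ℕ → ℕ → ℕ :=
  Function.update m a (Function.update (m a) i z)

/-- How queries are answered: the arguments are the choice of the co-family, the adjacency matrix
and the two nodes. -/
abbrev Oracle : Type := Bool → (ℕ → ℕ → ℕ) → ℕ → ℕ → Option (ℕ → ℕ)

/-- The effect of a query on the memory. -/
def State.answer (s : State) (x b k : ℕ) : Option (ℕ → ℕ) → State
  | none => { s with reg := Function.update s.reg x 0 }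
  | some z => { s with reg := Function.update s.reg x 1, arr := updateRow s.arr b k z }

/-- `Runs O p s t s'`: started in memory state `s`, the program `p` halts after `t` steps in state
`s'`.  Every assignment, every evaluation of a test and every query is one step. -/
inductive Runs (O : Oracle) : Program → State → ℕ → State → Prop where
  | skip (s : State) : Runs O .skip s 1 s
  | setReg (s : State) (x : ℕ) (e : NatExpr) :
      Runs O (.setReg x e) s 1 { s with reg := Function.update s.reg x (e.eval s) }
  | setArr (s : State) (a : ℕ) (i j e : NatExpr) :
      Runs O (.setArr a i j e) s 1
        { s with arr := updateEntry s.arr a (i.eval s) (j.eval s) (e.eval s) }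
  | setCostReg (s : State) (x : ℕ) (e : CostExpr) :
      Runs O (.setCostReg x e) s 1 { s with costReg := Function.update s.costReg x (e.eval s) }
  | setCostArr (s : State) (a : ℕ) (i j : NatExpr) (e : CostExpr) :
      Runs O (.setCostArr a i j e) s 1
        { s with costArr := updateEntry s.costArr a (i.eval s) (j.eval s) (e.eval s) }
  | seq {p q : Program} {s s' s'' : State} {t t' : ℕ} :
      Runs O p s t s' → Runs O q s' t' s'' → Runs O (.seq p q) s (t + t') s''
  | condTrue {b : Test} {p q : Program} {s s' : State} {t : ℕ} :
      b.Holds s → Runs O p s t s' → Runs O (.cond b p q) s (t + 1) s'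
  | condFalse {b : Test} {p q : Program} {s s' : State} {t : ℕ} :
      ¬ b.Holds s → Runs O q s t s' → Runs O (.cond b p q) s (t + 1) s'
  | loopDone {b : Test} {p : Program} {s : State} :
      ¬ b.Holds s → Runs O (.loop b p) s 1 s
  | loopStep {b : Test} {p : Program} {s s' s'' : State} {t t' : ℕ} :
      b.Holds s → Runs O p s t s' → Runs O (.loop b p) s' t' s'' →
        Runs O (.loop b p) s (t + t' + 1) s''
  | query (s : State) (co : Bool) (a : ℕ) (u v : NatExpr) (x b : ℕ) (k : NatExpr) :
      Runs O (.query co a u v x b k) s 1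
        (s.answer x b (k.eval s) (O co (s.arr a) (u.eval s) (v.eval s)))

/-! ### Input, queries and output of a program for the covering problem -/

/-- The edge set on `Fin n` whose adjacency matrix is the `n × n` part of `m`. -/
def edgesOf (n : ℕ) (m : ℕ → ℕ → ℕ) : Finset (Fin n × Fin n) :=
  {e | m e.1 e.2 ≠ 0}

/-- The characteristic vector of a node set. -/
def indicator {n : ℕ} (X : Finset (Fin n)) : ℕ → ℕ :=
  fun i => if ∃ h : i < n, (⟨i, h⟩ : Fin n) ∈ X then 1 else 0

/-- The answers to the queries of a program that accesses the family `F`: the core of `F^J(u,v)`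
or of its co-family, as a characteristic vector, or `none` if `F^J(u,v)` is empty. -/
def familyOracle {n : ℕ} (S T : Finset (Fin n)) (F : Set (Finset (Fin n))) : Oracle :=
  fun co m u v =>
    if h : u < n ∧ v < n then
      (core (if co then coFamily (residual S T F (edgesOf n m) ⟨u, h.1⟩ ⟨v, h.2⟩)
        else residual S T F (edgesOf n m) ⟨u, h.1⟩ ⟨v, h.2⟩)).map indicator
    else none

/-- The initial memory: variable `0` holds `n`, rows `0` and `1` of array `0` hold the sets `S` and
`T`, array `1` holds the adjacency matrix of `E`, cost array `0` holds the costs of the edges in `E`,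
and everything else is `0`. -/
def initialState {n : ℕ} (S T : Finset (Fin n)) (E : Finset (Fin n × Fin n))
    (c : Fin n × Fin n → ℝ) : State where
  reg := fun x => if x = 0 then n else 0
  arr := fun a i j =>
    if a = 0 then (if i = 0 then indicator S j else if i = 1 then indicator T j else 0)
    else if a = 1 then
      (if ∃ (hi : i < n) (hj : j < n), ((⟨i, hi⟩, ⟨j, hj⟩) : Fin n × Fin n) ∈ E then 1 else 0)
    else 0
  costReg := fun _ => 0
  costArr := fun a i j =>
    if a = 0 then
      (if h : i < n ∧ j < n then
        (if ((⟨i, h.1⟩, ⟨j, h.2⟩) : Fin n × Fin n) ∈ E then c (⟨i, h.1⟩, ⟨j, h.2⟩) else 0)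
      else 0)
    else 0

/-- The output of a program: the edge set whose adjacency matrix is in array `2`. -/
def output (n : ℕ) (s : State) : Finset (Fin n × Fin n) :=
  edgesOf n (s.arr 2)

end EdgeCover

end

/-! Edges run from `S` to `T`, so a coverable family is proper: each member meets `S` and misses a
node of `T`. Crossing then makes two cores equal as soon as they share a node of `S` and miss a
common node of `T`. The halo of a core `C` consists of the members that contain `C` and no other
core.

The logarithm comes from phases, each of which covers the halos of all current cores. A set that
survives a phase contains at least two old cores, since otherwise it would belong to a halo. Hence,
for every fixed `t ∈ T`, the number of cores avoiding `t` is at least halved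
(`two_mul_card_coresAvoiding_le`). It is at most `n` at the start, so at most `Nat.log 2 n + 1`
phases find anything uncovered.

Each phase costs at most the value of any fractional cover. Within one halo, intersections of
members that miss a common node of `T` stay in the halo, and this suffices for a primal-dual method
with reverse deletion that loses no constant factor (`primal_dual`). The dual variable of a set `X`
containing every uncovered member that misses a node of `T` together with `X` is raised. After
reverse deletion each kept edge has a private witness set, and intersecting two witnesses shows that
at most one kept edge covers `X` (`eq_of_covers_top`). An edge covers members of at most one halo
(`eq_of_covers_halo`), so different halos charge disjoint sets of edges and their bounds add up to a
single LP value (`IsPhase.step`, `IsProgress.step`).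

The queries see only the families `F^J(u,v)`, not halos. A halo is imitated by adding to `J`
artificial edges into `v` from every core that avoids `v` and a chosen node of `C`
(`residual_union_eq_halo`). Cores are recognized by comparing least members for different source
nodes (`isCore_iff_of_isLeast`).

The program is written in a language with bounded loops only. Its denotational semantics `Cmd.exec`
is realized by the machine within a polynomial number of steps (`runs_exec`), whether or not `E`
covers the family; correctness is then proved about `exec` by loop invariants. -/

noncomputable section

namespace EdgeCover

section

/-! ### Cores and halos -/

variable {n : ℕ}

/-- The members of `F` that are not covered by `J`. -/
def uncovered (F : Set (Finset (Fin n))) (J : Finset (Fin n × Fin n)) : Set (Finset (Fin n)) :=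
  {X | X ∈ F ∧ ∀ e ∈ J, ¬ Covers e X}

/-- Every member meets `S` and misses a node of `T`. -/
def IsProper (S T : Finset (Fin n)) (F : Set (Finset (Fin n))) : Prop :=
  ∀ X ∈ F, (∃ s ∈ S, s ∈ X) ∧ ∃ t ∈ T, t ∉ X

/-- The members of `F` that contain the core `C` and no other core. -/
def halo (F : Set (Finset (Fin n))) (C : Finset (Fin n)) : Set (Finset (Fin n)) :=
  {X | X ∈ F ∧ C ⊆ X ∧ ∀ D, IsCore F D → D ⊆ X → D = C}

variable {S T : Finset (Fin n)} {F : Set (Finset (Fin n))}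

theorem uncovered_antitone {J J' : Finset (Fin n × Fin n)} (h : J ⊆ J') :
    uncovered F J' ⊆ uncovered F J :=
  fun _ hX => ⟨hX.1, fun e he => hX.2 e (h he)⟩

theorem isEdgeCover_iff_uncovered {J : Finset (Fin n × Fin n)} :
    IsEdgeCover J F ↔ uncovered F J = ∅ := by
  rw [Set.eq_empty_iff_forall_notMem]
  refine forall_congr' fun X => ?_
  simp only [uncovered, Set.mem_ofPred_eq, not_and, not_forall, not_not, exists_prop]

theorem IsEdgeCover.isProper {E : Finset (Fin n × Fin n)} (h : IsEdgeCover E F)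
    (hE : E ⊆ S ×ˢ T) : IsProper S T F := by
  intro X hX
  obtain ⟨e, he, h1, h2⟩ := h X hX
  have := Finset.mem_product.1 (hE he)
  exact ⟨⟨_, this.1, h1⟩, ⟨_, this.2, h2⟩⟩

theorem IsProper.uncovered (h : IsProper S T F) (J : Finset (Fin n × Fin n)) :
    IsProper S T (uncovered F J) :=
  fun X hX => h X hX.1

theorem IsSTCrossing.inter_mem (hF : IsSTCrossing S T F) {X Y : Finset (Fin n)} (hX : X ∈ F)
    (hY : Y ∈ F) {s t : Fin n} (hs : s ∈ S) (hsX : s ∈ X) (hsY : s ∈ Y) (ht : t ∈ T)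
    (htX : t ∉ X) (htY : t ∉ Y) : X ∩ Y ∈ F :=
  (hF X hX Y hY ⟨⟨s, by simp [*]⟩, ⟨t, by simp [*]⟩⟩).1

theorem IsSTCrossing.uncovered (hF : IsSTCrossing S T F) (J : Finset (Fin n × Fin n)) :
    IsSTCrossing S T (uncovered F J) := by
  intro X hX Y hY h
  obtain ⟨h1, h2⟩ := hF X hX.1 Y hY.1 h
  refine ⟨⟨h1, fun e he => ?_⟩, ⟨h2, fun e he => ?_⟩⟩
  all_goals
    have := hX.2 e he
    have := hY.2 e he
    simp only [Covers, Finset.mem_inter, Finset.mem_union] at *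
    tauto

theorem exists_core_subset {X : Finset (Fin n)} (hX : X ∈ F) : ∃ C, IsCore F C ∧ C ⊆ X := by
  obtain ⟨C, h1, h2⟩ := (Set.toFinite F).exists_le_minimal hX
  exact ⟨C, h2, h1⟩

/-- The shared node of `S` and the common missed node of `T` put `C ∩ X` into the family, and
minimality of `C` does the rest. -/
theorem IsCore.subset_of_mem (hF : IsSTCrossing S T F) {C X : Finset (Fin n)} (hC : IsCore F C)
    (hX : X ∈ F) {s t : Fin n} (hs : s ∈ S) (hsC : s ∈ C) (hsX : s ∈ X) (ht : t ∈ T)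
    (htC : t ∉ C) (htX : t ∉ X) : C ⊆ X :=
  (hC.2 (hF.inter_mem hC.1 hX hs hsC hsX ht htC htX) Finset.inter_subset_left).trans
    Finset.inter_subset_right

theorem IsCore.eq_of_mem (hF : IsSTCrossing S T F) {C D : Finset (Fin n)} (hC : IsCore F C)
    (hD : IsCore F D) {s t : Fin n} (hs : s ∈ S) (hsC : s ∈ C) (hsD : s ∈ D) (ht : t ∈ T)
    (htC : t ∉ C) (htD : t ∉ D) : C = D :=
  (hC.subset_of_mem hF hD.1 hs hsC hsD ht htC htD).antisymm
    (hD.subset_of_mem hF hC.1 hs hsD hsC ht htD htC)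

/-- A common missed node of `T` is enough here: the node of `S` needed for crossing is supplied by
`C`, which lies in every member of its halo. -/
theorem halo_inter_mem (hF : IsSTCrossing S T F) (hP : IsProper S T F) {C : Finset (Fin n)}
    (hC : C ∈ F) {X Y : Finset (Fin n)} (hX : X ∈ halo F C) (hY : Y ∈ halo F C) {t : Fin n}
    (ht : t ∈ T) (htX : t ∉ X) (htY : t ∉ Y) : X ∩ Y ∈ halo F C := by
  obtain ⟨⟨s, hs, hsC⟩, -⟩ := hP C hC
  exact ⟨hF.inter_mem hX.1 hY.1 hs (hX.2.1 hsC) (hY.2.1 hsC) ht htX htY,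
    Finset.subset_inter hX.2.1 hY.2.1,
    fun D hD h => hX.2.2 D hD (h.trans Finset.inter_subset_left)⟩

/-- An edge covers members of at most one halo. -/
theorem eq_of_covers_halo (hF : IsSTCrossing S T F) {C D X Y : Finset (Fin n)}
    (hX : X ∈ halo F C) (hY : Y ∈ halo F D) {e : Fin n × Fin n} (he : e ∈ S ×ˢ T)
    (heX : Covers e X) (heY : Covers e Y) : C = D := by
  obtain ⟨h1, h2⟩ := Finset.mem_product.1 he
  obtain ⟨B, hB, hBs⟩ := exists_core_subset
    (hF.inter_mem hX.1 hY.1 h1 heX.1 heY.1 h2 heX.2 heY.2)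
  rw [← hX.2.2 B hB (hBs.trans Finset.inter_subset_left),
    hY.2.2 B hB (hBs.trans Finset.inter_subset_right)]

open Classical in
/-- The cores of `F` that avoid `t`. -/
def coresAvoiding (F : Set (Finset (Fin n))) (t : Fin n) : Finset (Finset (Fin n)) :=
  {C | IsCore F C ∧ t ∉ C}

theorem mem_coresAvoiding {t : Fin n} {C : Finset (Fin n)} :
    C ∈ coresAvoiding F t ↔ IsCore F C ∧ t ∉ C := by
  simp [coresAvoiding]

/-- Choosing a node of `S` in each of these cores is injective, because they all miss `t`. -/
theorem card_coresAvoiding_le (hF : IsSTCrossing S T F) (hP : IsProper S T F) {t : Fin n}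
    (ht : t ∈ T) : (coresAvoiding F t).card ≤ n := by
  have h : ∀ C ∈ coresAvoiding F t, ∃ s, s ∈ S ∧ s ∈ C := fun C hC => by
    obtain ⟨⟨s, h1, h2⟩, -⟩ := hP C (mem_coresAvoiding.1 hC).1.1
    exact ⟨s, h1, h2⟩
  have : Nonempty (Fin n) := ⟨t⟩
  choose! f hf using h
  have hinj : Set.InjOn f (coresAvoiding F t) := by
    intro C hC D hD hCD
    have hC' := mem_coresAvoiding.1 hC
    have hD' := mem_coresAvoiding.1 hD
    exact hC'.1.eq_of_mem hF hD'.1 (hf C hC).1 (hf C hC).2 (hCD ▸ (hf D hD).2) ht hC'.2 hD'.2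
  calc _ = ((coresAvoiding F t).image f).card := (Finset.card_image_of_injOn hinj).symm
    _ ≤ (Finset.univ : Finset (Fin n)).card := Finset.card_le_univ _
    _ = n := by simp

/-- Covering all halos at least halves the number of cores that avoid a given node. -/
theorem two_mul_card_coresAvoiding_le (hF : IsSTCrossing S T F) (hP : IsProper S T F)
    {J : Finset (Fin n × Fin n)} (hJ : ∀ C, IsCore F C → IsEdgeCover J (halo F C)) {t : Fin n}
    (ht : t ∈ T) :
    2 * (coresAvoiding (uncovered F J) t).card ≤ (coresAvoiding F t).card := by
  classical
  set f : Finset (Fin n) → Finset (Finset (Fin n)) := fun D =>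
    (coresAvoiding F t).filter (· ⊆ D) with hf
  have hdisj : ∀ D ∈ coresAvoiding (uncovered F J) t, ∀ D' ∈ coresAvoiding (uncovered F J) t,
      D ≠ D' → Disjoint (f D) (f D') := by
    intro D hD D' hD' hne
    rw [Finset.disjoint_left]
    intro C hC hC'
    simp only [hf, Finset.mem_filter, mem_coresAvoiding] at hC hC'
    obtain ⟨⟨s, hs, hsC⟩, -⟩ := hP C hC.1.1.1
    rw [mem_coresAvoiding] at hD hD'
    exact hne (hD.1.eq_of_mem (hF.uncovered J) hD'.1 hs (hC.2 hsC) (hC'.2 hsC) ht hD.2 hD'.2)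
  have htwo : ∀ D ∈ coresAvoiding (uncovered F J) t, 2 ≤ (f D).card := by
    intro D hD
    rw [mem_coresAvoiding] at hD
    obtain ⟨C, hC, hCD⟩ := exists_core_subset hD.1.1.1
    -- With `C` as its only core, `D` would lie in the halo of `C` and so be covered by `J`.
    have : ∃ C', IsCore F C' ∧ C' ⊆ D ∧ C' ≠ C := by
      by_contra! h
      obtain ⟨e, he, hcov⟩ := hJ C hC D ⟨hD.1.1.1, hCD, fun C' h1 h2 => h C' h1 h2⟩
      exact hD.1.1.2 e he hcov
    obtain ⟨C', hC', hCD', hne⟩ := this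
    have hsub : ({C, C'} : Finset (Finset (Fin n))) ⊆ f D := by
      intro B hB
      simp only [Finset.mem_insert, Finset.mem_singleton] at hB
      simp only [hf, Finset.mem_filter, mem_coresAvoiding]
      rcases hB with rfl | rfl
      · exact ⟨⟨hC, fun h => hD.2 (hCD h)⟩, hCD⟩
      · exact ⟨⟨hC', fun h => hD.2 (hCD' h)⟩, hCD'⟩
    calc 2 = ({C, C'} : Finset (Finset (Fin n))).card := (Finset.card_pair hne.symm).symm
      _ ≤ _ := Finset.card_le_card hsub
  calc 2 * (coresAvoiding (uncovered F J) t).card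
      = ∑ _D ∈ coresAvoiding (uncovered F J) t, 2 := by simp [mul_comm]
    _ ≤ ∑ D ∈ coresAvoiding (uncovered F J) t, (f D).card := Finset.sum_le_sum htwo
    _ = ((coresAvoiding (uncovered F J) t).biUnion f).card := (Finset.card_biUnion hdisj).symm
    _ ≤ (coresAvoiding F t).card := Finset.card_le_card fun C hC => by
        obtain ⟨D, -, h⟩ := Finset.mem_biUnion.1 hC
        exact (Finset.mem_filter.1 h).1

theorem eq_empty_of_coresAvoiding (hP : IsProper S T F)
    (h : ∀ t ∈ T, (coresAvoiding F t).card = 0) : F = ∅ := by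
  rw [Set.eq_empty_iff_forall_notMem]
  intro X hX
  obtain ⟨C, hC, -⟩ := exists_core_subset hX
  obtain ⟨-, t, ht, htC⟩ := hP C hC.1
  have := Finset.card_eq_zero.1 (h t ht)
  exact Finset.notMem_empty C (this ▸ mem_coresAvoiding.2 ⟨hC, htC⟩)

/-! ### Recognizing cores and halos by queries -/

theorem mem_residual {J : Finset (Fin n × Fin n)} {u v : Fin n} {X : Finset (Fin n)} :
    X ∈ residual S T F J u v ↔
      X ∈ uncovered F J ∧ u ∈ S ∧ u ∈ X ∧ v ∈ T ∧ v ∉ X := by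
  simp only [residual, uncovered, Set.mem_ofPred_eq, Finset.mem_inter, Finset.mem_sdiff]
  tauto

theorem isLeast_residual_of_isCore (hF : IsSTCrossing S T F) {J : Finset (Fin n × Fin n)}
    {u v : Fin n} {C : Finset (Fin n)} (hC : IsCore (uncovered F J) C) (hu : u ∈ S) (huC : u ∈ C)
    (hv : v ∈ T) (hvC : v ∉ C) : IsLeast (residual S T F J u v) C :=
  ⟨mem_residual.2 ⟨hC.1, hu, huC, hv, hvC⟩, fun X hX => by
    obtain ⟨h1, -, h2, -, h3⟩ := mem_residual.1 hX
    exact hC.subset_of_mem (hF.uncovered J) h1 hu huC h2 hv hvC h3⟩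

/-- If `C` is a core, it is itself the least member for every source `a ∈ C ∩ S`. Conversely, let `Y
⊆ C` be uncovered and `a ∈ Y ∩ S`: the least member `D` for `a` lies in `Y`, and `u ∈ D` makes `D` a
competitor of `C`, so `C ⊆ D ⊆ Y`. The criterion can be tested by queries. -/
theorem isCore_iff_of_isLeast (hF : IsSTCrossing S T F) (hP : IsProper S T F)
    {J : Finset (Fin n × Fin n)} {u v : Fin n} {C : Finset (Fin n)}
    (hC : IsLeast (residual S T F J u v) C) :
    IsCore (uncovered F J) C ↔
      ∀ a ∈ C, ∀ D, IsLeast (residual S T F J a v) D → u ∈ D := by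
  obtain ⟨h1, hu, huC, hv, hvC⟩ := mem_residual.1 hC.1
  constructor
  · intro hcore a ha D hD
    have haS := (mem_residual.1 hD.1).2.1
    have := hD.unique (isLeast_residual_of_isCore hF hcore haS ha hv hvC)
    rwa [this]
  · intro h
    refine ⟨h1, fun Y hY hYC => ?_⟩
    obtain ⟨⟨a, haS, haY⟩, -⟩ := hP Y hY.1
    have hYr : Y ∈ residual S T F J a v :=
      mem_residual.2 ⟨hY, haS, haY, hv, fun h' => hvC (hYC h')⟩
    have hne : ∃ D, IsLeast (residual S T F J a v) D := by
      obtain ⟨D, hD, -⟩ := exists_core_subset hYr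
      refine ⟨D, hD.1, fun X hX => ?_⟩
      exact (hD.2 (residual_closed hF J a v hD.1 hX).1 Finset.inter_subset_left).trans
        Finset.inter_subset_right
    obtain ⟨D, hD⟩ := hne
    have huD := h a (hYC haY) D hD
    have hDr : D ∈ residual S T F J u v := by
      obtain ⟨g1, -, -, -, g2⟩ := mem_residual.1 hD.1
      exact mem_residual.2 ⟨g1, hu, huD, hv, g2⟩
    exact (hC.2 hDr).trans (hD.2 hYr)

/-- Membership in a halo is enforced by asking about additional edges. -/
theorem residual_union_eq_halo (hF : IsSTCrossing S T F) (hP : IsProper S T F)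
    {J₀ J B : Finset (Fin n × Fin n)} (hJ : J₀ ⊆ J) {s v : Fin n} {C : Finset (Fin n)}
    (hC : IsCore (uncovered F J₀) C) (hs : s ∈ S) (hsC : s ∈ C) (hv : v ∈ T) (hvC : v ∉ C)
    (hB : ∀ e, e ∈ B ↔ e.2 = v ∧
      ∃ D, IsCore (uncovered F J₀) D ∧ e.1 ∈ S ∧ e.1 ∈ D ∧ v ∉ D ∧ s ∉ D) :
    residual S T F (J ∪ B) s v = {X | X ∈ uncovered (halo (uncovered F J₀) C) J ∧ v ∉ X} := by
  have hF₀ := hF.uncovered J₀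
  ext X
  rw [mem_residual]
  constructor
  · rintro ⟨h1, -, hsX, -, hvX⟩
    have hXJ := uncovered_antitone Finset.subset_union_left h1
    have hX₀ := uncovered_antitone hJ hXJ
    refine ⟨⟨⟨hX₀, hC.subset_of_mem hF₀ hX₀ hs hsC hsX hv hvC hvX, fun D hD hDX => ?_⟩,
      hXJ.2⟩, hvX⟩
    have hvD : v ∉ D := fun h => hvX (hDX h)
    by_cases hsD : s ∈ D
    · exact hD.eq_of_mem hF₀ hC hs hsD hsC hv hvD hvC
    · obtain ⟨⟨a, haS, haD⟩, -⟩ := hP D hD.1.1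
      -- A second core inside `X` would emit an artificial edge into `v` that covers `X`.
      exact (h1.2 (a, v) (Finset.mem_union_right _ ((hB _).2 ⟨rfl, D, hD, haS, haD, hvD, hsD⟩))
        ⟨hDX haD, hvX⟩).elim
  · rintro ⟨⟨h1, h2⟩, hvX⟩
    refine ⟨⟨h1.1.1, fun e he => ?_⟩, hs, h1.2.1 hsC, hv, hvX⟩
    rcases Finset.mem_union.1 he with he | he
    · exact h2 e he
    · rintro ⟨h3, h4⟩
      obtain ⟨h5, D, hD, haS, haD, hvD, hsD⟩ := (hB e).1 he
      -- If an artificial edge covered `X`, the core at its tail would share that tail with `X` and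
      -- miss `v` with it, hence lie in `X` and equal `C`; but it avoids `s`.
      have := h1.2.2 D hD (hD.subset_of_mem hF₀ h1.1 haS haD h3 hv hvD hvX)
      exact hsD (this ▸ hsC)

end

section

/-! ### The primal-dual method with reverse deletion -/

variable {n : ℕ}

/-- `X` contains every member of `G` that misses a common node of `T` with `X`. -/
def IsTop (T : Finset (Fin n)) (G : Set (Finset (Fin n))) (X : Finset (Fin n)) : Prop :=
  X ∈ G ∧ ∀ W ∈ G, ∀ t ∈ T, t ∉ X → t ∉ W → W ⊆ X

/-- The dual variable of an uncovered set is raised until an edge becomes tight, and this edge is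
added; `r` are the reduced costs. -/
def IsAugmentation (T : Finset (Fin n)) (E : Finset (Fin n × Fin n)) (G : Set (Finset (Fin n)))
    (J J' : Finset (Fin n × Fin n)) (r r' : Fin n × Fin n → ℝ)
    (o : Option (Fin n × Fin n)) : Prop :=
  (uncovered G J = ∅ ∧ J' = J ∧ r' = r ∧ o = none) ∨
    ∃ X, IsTop T (uncovered G J) X ∧ ∃ e ∈ E, Covers e X ∧ (∀ f ∈ E, Covers f X → r e ≤ r f) ∧
      J' = insert e J ∧ (∀ f, Covers f X → r' f = r f - r e) ∧ (∀ f, ¬ Covers f X → r' f = r f) ∧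
      o = some e

/-- An edge is deleted if the other edges suffice. -/
def IsDeletion (G : Set (Finset (Fin n))) (D D' : Finset (Fin n × Fin n))
    (o : Option (Fin n × Fin n)) : Prop :=
  (o = none ∧ D' = D) ∨ ∃ e, o = some e ∧
    ((uncovered G (D.erase e) = ∅ ∧ D' = D.erase e) ∨
      ((uncovered G (D.erase e)).Nonempty ∧ D' = D))

section

variable {T : Finset (Fin n)} {E : Finset (Fin n × Fin n)} {G : Set (Finset (Fin n))}
  {J D : ℕ → Finset (Fin n × Fin n)} {r : ℕ → Fin n × Fin n → ℝ}
  {o : ℕ → Option (Fin n × Fin n)} {N : ℕ} {c : Fin n × Fin n → ℝ}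

theorem IsAugmentation.subset {J J' : Finset (Fin n × Fin n)} {r r' : Fin n × Fin n → ℝ}
    {o : Option (Fin n × Fin n)} (h : IsAugmentation T E G J J' r r' o) : J ⊆ J' := by
  rcases h with ⟨-, rfl, -⟩ | ⟨X, -, e, -, -, -, rfl, -⟩
  · exact subset_rfl
  · exact Finset.subset_insert _ _

theorem IsAugmentation.notMem {J J' : Finset (Fin n × Fin n)} {r r' : Fin n × Fin n → ℝ}
    {e : Fin n × Fin n} (h : IsAugmentation T E G J J' r r' (some e)) :
    e ∈ E ∧ e ∉ J ∧ e ∈ J' := by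
  rcases h with ⟨-, -, -, h⟩ | ⟨X, hX, f, hf, hfX, -, rfl, -, -, h⟩
  · simp at h
  · cases h
    exact ⟨hf, fun h => hX.1.2 _ h hfX, Finset.mem_insert_self _ _⟩

theorem augmentation_mono (h : ∀ k < N, IsAugmentation T E G (J k) (J (k + 1)) (r k) (r (k + 1)) (o k))
    {i j : ℕ} (hij : i ≤ j) (hj : j ≤ N) : J i ⊆ J j := by
  induction j, hij using Nat.le_induction with
  | base => exact subset_rfl
  | succ m _ ih => exact (ih (by omega)).trans (h m (by omega)).subset

/-- Either some round finds nothing uncovered, or each of at least `n * n` rounds adds a new pair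
and in the end all pairs are present. -/
theorem augmentation_covers
    (h : ∀ k < N, IsAugmentation T E G (J k) (J (k + 1)) (r k) (r (k + 1)) (o k))
    (hE : IsEdgeCover E G) (hN : n * n ≤ N) : uncovered G (J N) = ∅ := by
  by_cases hall : ∃ k < N, uncovered G (J k) = ∅
  · obtain ⟨k, hk, hemp⟩ := hall
    exact Set.subset_empty_iff.1
      ((uncovered_antitone (augmentation_mono h hk.le le_rfl)).trans hemp.subset)
  · push Not at hall
    have hcard : ∀ k ≤ N, k ≤ (J k).card := by
      intro k
      induction k with
      | zero => simp
      | succ m ih =>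
        intro hm
        rcases h m hm with ⟨h1, -⟩ | ⟨X, hX, e, -, heX, -, h2, -⟩
        · exact absurd h1 (hall m hm).ne_empty
        · rw [h2, Finset.card_insert_of_notMem fun h => hX.1.2 e h heX]
          exact Nat.succ_le_succ (ih (by omega))
    have huniv : J N = Finset.univ := by
      refine Finset.eq_univ_of_card _ (le_antisymm (Finset.card_le_univ _) ?_)
      simpa using hN.trans (hcard N le_rfl)
    rw [huniv, ← isEdgeCover_iff_uncovered]
    intro X hX
    obtain ⟨e, -, h⟩ := hE X hX
    exact ⟨e, Finset.mem_univ _, h⟩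

theorem exists_of_mem_augmentation
    (h : ∀ k < N, IsAugmentation T E G (J k) (J (k + 1)) (r k) (r (k + 1)) (o k))
    {f : Fin n × Fin n} {k : ℕ} (hk : k ≤ N) (hf : f ∈ J k) :
    f ∈ J 0 ∨ ∃ i < k, o i = some f := by
  induction k with
  | zero => exact Or.inl hf
  | succ m ih =>
    have ih' : f ∈ J m → _ := fun h => (ih (by omega) h).imp_right fun ⟨i, hi, h⟩ =>
      (⟨i, by omega, h⟩ : ∃ i < m + 1, o i = some f)
    rcases h m hk with ⟨-, h2, -⟩ | ⟨X, hX, e, -, heX, -, h2, -, -, h3⟩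
    · exact ih' (h2 ▸ hf)
    · rw [h2, Finset.mem_insert] at hf
      rcases hf with rfl | hf
      · exact Or.inr ⟨m, by omega, h3⟩
      · exact ih' hf

/-- Deletion step `j` examines the edge added in round `N - 1 - j`. Hence after `k` steps the edges
of `J (N - k)` are all still there, and every surviving edge examined so far has a private witness.
The witness was uncovered when the edge was added, since all earlier edges were present when it was
found; later deletions only remove further edges and keep it private. -/
theorem deletion_invariant
    (h : ∀ k < N, IsAugmentation T E G (J k) (J (k + 1)) (r k) (r (k + 1)) (o k))
    (hcov : uncovered G (J N) = ∅) (h0 : D 0 = J N) {k : ℕ} (hk : k ≤ N)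
    (hD : ∀ j < k, IsDeletion G (D j) (D (j + 1)) (o (N - 1 - j))) :
    J (N - k) ⊆ D k ∧ D k ⊆ J N ∧ uncovered G (D k) = ∅ ∧
      ∀ i < N, N - k ≤ i → ∀ e ∈ D k, o i = some e →
        ∃ W ∈ uncovered G (J i), W ∈ uncovered G ((D k).erase e) := by
  induction k with
  | zero =>
    refine ⟨by simp [h0], by simp [h0], by simpa [h0], fun i hi hi' => ?_⟩
    omega
  | succ m ih =>
    obtain ⟨h1, h2, h3, h4⟩ := ih (by omega) fun j hj => hD j (by omega)
    have hidx : N - 1 - m = N - (m + 1) := by omega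
    have haug := h (N - (m + 1)) (by omega)
    have hsub : J (N - (m + 1)) ⊆ J (N - m) := augmentation_mono h (by omega) (by omega)
    have hsplit : ∀ i, N - (m + 1) ≤ i → i = N - (m + 1) ∨ N - m ≤ i := by omega
    rcases hD m (by omega) with ⟨h5, h6⟩ | ⟨e, h5, h6⟩
    · rw [hidx] at h5
      rw [h6]
      refine ⟨hsub.trans h1, h2, h3, fun i hi hi' f hf hof => ?_⟩
      rcases hsplit i hi' with rfl | hi'
      · simp [h5] at hof
      · exact h4 i hi hi' f hf hof
    · rw [hidx] at h5
      rw [h5] at haug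
      have hne := haug.notMem
      have hsub' : J (N - (m + 1)) ⊆ (D m).erase e := fun f hf =>
        Finset.mem_erase.2 ⟨fun h => hne.2.1 (h ▸ hf), h1 (hsub hf)⟩
      rcases h6 with ⟨h6, h7⟩ | ⟨⟨W, hW⟩, h7⟩
      · rw [h7]
        refine ⟨hsub', (Finset.erase_subset _ _).trans h2, h6, fun i hi hi' f hf hof => ?_⟩
        rcases hsplit i hi' with rfl | hi'
        · rw [h5] at hof
          cases hof
          simp at hf
        · obtain ⟨W, hW, hW'⟩ := h4 i hi hi' f (Finset.mem_of_mem_erase hf) hof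
          exact ⟨W, hW, uncovered_antitone
            (Finset.erase_subset_erase _ (Finset.erase_subset _ _)) hW'⟩
      · rw [h7]
        refine ⟨hsub.trans h1, h2, h3, fun i hi hi' f hf hof => ?_⟩
        rcases hsplit i hi' with rfl | hi'
        · rw [h5] at hof
          cases hof
          exact ⟨W, uncovered_antitone hsub' hW, hW⟩
        · exact h4 i hi hi' f hf hof

/-- Two edges of a set `K` all of whose edges have private witnesses do not cover the same set that
was raised before both of them were added. -/
theorem eq_of_covers_top (hG : ∀ X ∈ G, ∀ Y ∈ G, ∀ t ∈ T, t ∉ X → t ∉ Y → X ∩ Y ∈ G)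
    {J K : Finset (Fin n × Fin n)} (hK : uncovered G K = ∅) {X W W' : Finset (Fin n)}
    (hX : IsTop T (uncovered G J) X) {e f : Fin n × Fin n} (heT : e.2 ∈ T) (hfT : f.2 ∈ T)
    (heX : Covers e X) (hfX : Covers f X) (hW : W ∈ uncovered G J) (hW' : W' ∈ uncovered G J)
    (heW : W ∈ uncovered G (K.erase e)) (hfW : W' ∈ uncovered G (K.erase f)) : e = f := by
  have key : ∀ {e W}, W ∈ G → W ∈ uncovered G (K.erase e) →
      ∀ g ∈ K, Covers g W → g = e := fun hW h g hg hgW => by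
    by_contra hne
    exact h.2 g (Finset.mem_erase.2 ⟨hne, hg⟩) hgW
  have hcov : ∀ Y ∈ G, ∃ g ∈ K, Covers g Y := isEdgeCover_iff_uncovered.2 hK
  have heW' : Covers e W := by
    obtain ⟨g, hg, hgW⟩ := hcov W hW.1
    exact key hW.1 heW g hg hgW ▸ hgW
  have hfW' : Covers f W' := by
    obtain ⟨g, hg, hgW⟩ := hcov W' hW'.1
    exact key hW'.1 hfW g hg hgW ▸ hgW
  -- The witness `W` misses the head of `e`, which `X` misses too, so it lies inside `X`; likewise
  -- `W'`. Both then miss `e.2`, and their intersection belongs to `G`.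
  have hWX := hX.2 W hW e.2 heT heX.2 heW'.2
  have hWX' := hX.2 W' hW' f.2 hfT hfX.2 hfW'.2
  obtain ⟨g, hg, hgW⟩ := hcov _ (hG W hW.1 W' hW'.1 e.2 heT heW'.2 fun h => heX.2 (hWX' h))
  have hg1 := Finset.mem_inter.1 hgW.1
  have hg2 : ¬ (g.2 ∈ W ∧ g.2 ∈ W') := fun h => hgW.2 (Finset.mem_inter.2 h)
  -- The edge `g` covering `W ∩ W'` covers `W` or `W'`, so it is `e` or `f`. Its head is then
  -- outside `X`, hence outside both witnesses, and `g` is the other edge as well.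
  by_cases h2 : g.2 ∈ W
  · have hgf : g = f := key hW'.1 hfW g hg ⟨hg1.2, fun h => hg2 ⟨h2, h⟩⟩
    have hge : g = e := key hW.1 heW g hg
      ⟨hg1.1, fun h => (hgf ▸ hfX.2) (hWX h)⟩
    exact hge.symm.trans hgf
  · have hge : g = e := key hW.1 heW g hg ⟨hg1.1, h2⟩
    have hgf : g = f := key hW'.1 hfW g hg
      ⟨hg1.2, fun h => (hge ▸ heX.2) (hWX' h)⟩
    exact hge.symm.trans hgf

open Classical in
/-- The final reduced costs in terms of the dual solution. -/
theorem exists_dual (hc : ∀ e ∈ E, 0 ≤ c e) (hr : r 0 = c)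
    (h : ∀ k < N, IsAugmentation T E G (J k) (J (k + 1)) (r k) (r (k + 1)) (o k)) :
    ∃ (X : ℕ → Finset (Fin n)) (y : ℕ → ℝ), (∀ k < N, 0 ≤ y k) ∧
      (∀ k < N, y k ≠ 0 → IsTop T (uncovered G (J k)) (X k)) ∧
      (∀ e ∈ E, ∑ k ∈ Finset.range N with Covers e (X k), y k ≤ c e) ∧
      ∀ k < N, ∀ e, o k = some e → ∑ k ∈ Finset.range N with Covers e (X k), y k = c e := by
  have hex : ∀ k, ∃ (X : Finset (Fin n)) (ε : ℝ), k < N →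
      (∀ f, r (k + 1) f = r k f - if Covers f X then ε else 0) ∧
      (ε ≠ 0 → IsTop T (uncovered G (J k)) X) ∧
      (∀ e, o k = some e → e ∈ E ∧ Covers e X ∧ r k e = ε) ∧
      (ε = 0 ∨ ∃ e ∈ E, r k e = ε) ∧
      (∀ f ∈ E, Covers f X → ε ≤ r k f ∨ ε = 0) ∧
      (∀ f ∈ J k, Covers f X → ε = 0) := by
    intro k
    by_cases hk : k < N
    · rcases h k hk with ⟨-, -, h3, h4⟩ | ⟨X, hX, e, he, heX, hmin, -, h5, h6, h7⟩
      -- An idle round is given a zero dual variable, for which the set is irrelevant.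
      · exact ⟨∅, 0, fun _ => by simp [h3, h4]⟩
      · refine ⟨X, r k e, fun _ => ⟨fun f => ?_, fun _ => hX, fun f hf => ?_,
          Or.inr ⟨e, he, rfl⟩, fun f hf hfX => Or.inl (hmin f hf hfX),
          fun f hf hfX => (hX.1.2 f hf hfX).elim⟩⟩
        · split_ifs with hf
          · exact h5 f hf
          · simpa using h6 f hf
        · rw [h7] at hf
          cases hf
          exact ⟨he, heX, rfl⟩
    · exact ⟨∅, 0, fun h => (hk h).elim⟩
  choose X y hXy using hex
  have hnn : ∀ k ≤ N, ∀ f ∈ E, 0 ≤ r k f := by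
    intro k
    induction k with
    | zero => simpa [hr] using hc
    | succ m ih =>
      intro hm f hf
      rw [(hXy m hm).1 f]
      split_ifs with hfX
      · rcases (hXy m hm).2.2.2.2.1 f hf hfX with h' | h'
        · linarith
        · rw [h']
          simpa using ih (by omega) f hf
      · simpa using ih (by omega) f hf
  have hsum : ∀ k ≤ N, ∀ f,
      r k f = c f - ∑ i ∈ Finset.range k, if Covers f (X i) then y i else 0 := by
    intro k
    induction k with
    | zero => simp [hr]
    | succ m ih =>
      intro hm f
      rw [(hXy m hm).1 f, ih (by omega), Finset.sum_range_succ]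
      ring
  -- The reduced cost of an added edge stays zero, because sets raised later are uncovered by a `J`
  -- containing that edge.
  have htight : ∀ k < N, ∀ e, o k = some e → ∀ j, k < j → j ≤ N → r j e = 0 := by
    intro k hk e he j hkj
    induction j, hkj using Nat.le_induction with
    | base =>
      intro _
      obtain ⟨-, h1, h2⟩ := (hXy k hk).2.2.1 e he
      rw [(hXy k hk).1, if_pos h1, h2, sub_self]
    | succ m hm ih =>
      intro hm'
      rw [(hXy m hm').1, ih (by omega)]
      have hmem : e ∈ J m := augmentation_mono h hm (by omega) ((he ▸ h k hk).notMem.2.2)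
      split_ifs with h'
      · rw [(hXy m hm').2.2.2.2.2 e hmem h', sub_self]
      · rw [sub_self]
  refine ⟨X, y, fun k hk => ?_, fun k hk => (hXy k hk).2.1, fun e he => ?_, fun k hk e he => ?_⟩
  · rcases (hXy k hk).2.2.2.1 with h' | ⟨e, he, h'⟩
    · exact h'.ge
    · exact h' ▸ hnn k hk.le e he
  · have := hnn N le_rfl e he
    rw [hsum N le_rfl] at this
    rw [Finset.sum_filter]
    linarith
  · have := htight k hk e he N hk le_rfl
    rw [hsum N le_rfl] at this
    rw [Finset.sum_filter]
    linarith

open Classical in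
/-- The primal-dual method with reverse deletion finds a cover whose cost is at most that of any
fractional cover, even if only the edges that cover an uncovered set are counted. -/
theorem primal_dual (hG : ∀ X ∈ G, ∀ Y ∈ G, ∀ t ∈ T, t ∉ X → t ∉ Y → X ∩ Y ∈ G)
    (hET : ∀ e ∈ E, e.2 ∈ T) (hE : IsEdgeCover E G) (hN : n * n ≤ N)
    (hc : ∀ e ∈ E, 0 ≤ c e) (hr : r 0 = c)
    (h : ∀ k < N, IsAugmentation T E G (J k) (J (k + 1)) (r k) (r (k + 1)) (o k))
    (h0 : D 0 = J N) (hD : ∀ k < N, IsDeletion G (D k) (D (k + 1)) (o (N - 1 - k))) :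
    J 0 ⊆ D N ∧ D N \ J 0 ⊆ E ∧ IsEdgeCover (D N) G ∧
      ∀ x, IsFractionalCover E G x → ∑ e ∈ D N \ J 0, c e ≤
        ∑ e ∈ E with ∃ X ∈ uncovered G (J 0), Covers e X, c e * x e := by
  have hcov := augmentation_covers h hE hN
  obtain ⟨h1, h2, h3, h4⟩ := deletion_invariant h hcov h0 le_rfl hD
  rw [Nat.sub_self] at h1 h4
  have hev : ∀ e ∈ D N \ J 0, ∃ i < N, o i = some e := fun e he => by
    rw [Finset.mem_sdiff] at he
    exact (exists_of_mem_augmentation h le_rfl (h2 he.1)).resolve_left he.2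
  have hsubE : D N \ J 0 ⊆ E := fun e he => by
    obtain ⟨i, hi, ho⟩ := hev e he
    exact (ho ▸ h i hi).notMem.1
  refine ⟨h1, hsubE, isEdgeCover_iff_uncovered.2 h3, fun x hx => ?_⟩
  obtain ⟨X, y, hy, hyX, hle, heq⟩ := exists_dual hc hr h
  have hone : ∀ k < N, y k ≠ 0 → ((D N \ J 0).filter fun e => Covers e (X k)).card ≤ 1 := by
    intro k hk hk0
    have hX := hyX k hk hk0
    rw [Finset.card_le_one]
    have hwit : ∀ e ∈ (D N \ J 0).filter (fun e => Covers e (X k)), e.2 ∈ T ∧ Covers e (X k) ∧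
        ∃ W ∈ uncovered G (J k), W ∈ uncovered G ((D N).erase e) := by
      intro e he
      rw [Finset.mem_filter] at he
      obtain ⟨i, hi, ho⟩ := hev e he.1
      obtain ⟨W, hW, hW'⟩ := h4 i hi (Nat.zero_le _) e (Finset.mem_sdiff.1 he.1).1 ho
      refine ⟨hET e (hsubE he.1), he.2, W, ?_, hW'⟩
      refine uncovered_antitone (augmentation_mono h ?_ hi.le) hW
      -- An edge added before round `k` belongs to `J k` and cannot cover the set raised in that
      -- round.
      by_contra! hik
      exact hX.1.2 e (augmentation_mono h hik hk.le (ho ▸ h i hi).notMem.2.2) he.2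
    intro e he f hf
    obtain ⟨he1, he2, W, hW, heW⟩ := hwit e he
    obtain ⟨hf1, hf2, W', hW', hfW⟩ := hwit f hf
    exact eq_of_covers_top hG h3 hX he1 hf1 he2 hf2 hW hW' heW hfW
  calc ∑ e ∈ D N \ J 0, c e
      = ∑ e ∈ D N \ J 0, ∑ k ∈ Finset.range N, if Covers e (X k) then y k else 0 := by
        refine Finset.sum_congr rfl fun e he => ?_
        obtain ⟨i, hi, ho⟩ := hev e he
        rw [← heq i hi e ho, Finset.sum_filter]
    _ = ∑ k ∈ Finset.range N, ∑ e ∈ D N \ J 0, if Covers e (X k) then y k else 0 :=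
        Finset.sum_comm
    -- A raised set is covered by at most one kept edge, but by a total weight of at least one in
    -- `x`.
    _ ≤ ∑ k ∈ Finset.range N, ∑ e ∈ E, if Covers e (X k) then y k * x e else 0 := by
        refine Finset.sum_le_sum fun k hk => ?_
        rw [Finset.mem_range] at hk
        rw [← Finset.sum_filter, ← Finset.sum_filter, Finset.sum_const, nsmul_eq_mul,
          ← Finset.mul_sum]
        by_cases hk0 : y k = 0
        · simp [hk0]
        · have h5 : (((D N \ J 0).filter fun e => Covers e (X k)).card : ℝ) ≤ 1 := by
            exact_mod_cast hone k hk hk0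
          have h6 := hx.1 (X k) (hyX k hk hk0).1.1
          nlinarith [hy k hk]
    _ = ∑ e ∈ E, ∑ k ∈ Finset.range N, if Covers e (X k) then y k * x e else 0 :=
        Finset.sum_comm
    _ ≤ ∑ e ∈ E, if ∃ X ∈ uncovered G (J 0), Covers e X then c e * x e else 0 := by
        refine Finset.sum_le_sum fun e he => ?_
        split_ifs with hex
        · rw [← Finset.sum_filter, ← Finset.sum_mul]
          exact mul_le_mul_of_nonneg_right (hle e he) (hx.2 e he)
        -- All raised sets are uncovered by `J 0`, so an edge that covers no such set receives no
        -- dual payment.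
        · refine (Finset.sum_eq_zero fun k hk => ?_).le
          rw [Finset.mem_range] at hk
          split_ifs with hek
          · by_cases hk0 : y k = 0
            · simp [hk0]
            · exact (hex ⟨X k, uncovered_antitone (augmentation_mono h (Nat.zero_le _) hk.le)
                (hyX k hk hk0).1, hek⟩).elim
          · rfl
    _ = _ := (Finset.sum_filter _ _).symm

end

end

section

/-! ### Phases -/

variable {n : ℕ} {S T : Finset (Fin n)} {F G : Set (Finset (Fin n))}
  {E J J' J₀ : Finset (Fin n × Fin n)} {c x : Fin n × Fin n → ℝ}

theorem IsFractionalCover.mono (hx : IsFractionalCover E F x) (h : G ⊆ F) :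
    IsFractionalCover E G x :=
  ⟨fun X hX => hx.1 X (h hX), hx.2⟩

theorem IsEdgeCover.mono (hJ : IsEdgeCover J F) (h : J ⊆ J') : IsEdgeCover J' F := fun X hX =>
  (hJ X hX).imp fun _ he => ⟨h he.1, he.2⟩

theorem IsEdgeCover.anti (hJ : IsEdgeCover J F) (h : G ⊆ F) : IsEdgeCover J G :=
  fun X hX => hJ X (h hX)

open Classical in
/-- The edges that cover a member of a halo all of whose members are covered by `J`. -/
def charged (E : Finset (Fin n × Fin n)) (F : Set (Finset (Fin n)))
    (J : Finset (Fin n × Fin n)) : Finset (Fin n × Fin n) :=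
  {e ∈ E | ∃ C, IsCore F C ∧ IsEdgeCover J (halo F C) ∧ ∃ X ∈ halo F C, Covers e X}

theorem mem_charged {e : Fin n × Fin n} : e ∈ charged E F J ↔
    e ∈ E ∧ ∃ C, IsCore F C ∧ IsEdgeCover J (halo F C) ∧ ∃ X ∈ halo F C, Covers e X := by
  simp [charged]

/-- The edges added during a phase that started with `J₀` are paid for by the edges that cover
members of the halos treated so far. -/
structure IsPhase (E : Finset (Fin n × Fin n)) (c : Fin n × Fin n → ℝ) (F : Set (Finset (Fin n)))
    (J₀ J : Finset (Fin n × Fin n)) : Prop where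
  subset : J₀ ⊆ J
  sdiff_subset : J \ J₀ ⊆ E
  cost_le : ∀ x, IsFractionalCover E F x →
    ∑ e ∈ J \ J₀, c e ≤ ∑ e ∈ charged E (uncovered F J₀) J, c e * x e

theorem isPhase_refl (hc : ∀ e ∈ E, 0 ≤ c e) : IsPhase E c F J J where
  subset := subset_rfl
  sdiff_subset := by simp
  cost_le x hx := by
    rw [sdiff_self, Finset.bot_eq_empty, Finset.sum_empty]
    exact Finset.sum_nonneg fun e he => by
      have := (mem_charged.1 he).1
      exact mul_nonneg (hc e this) (hx.2 e this)

open Classical in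
-- The newly charged edges cover a member of the halo of `C` still uncovered by `J`. None was
-- charged before: an edge determines the halo it serves, and earlier charges belong to halos
-- already covered by `J`. So the two bounds are sums over disjoint sets of edges. Treating the same
-- halo again is harmless.
theorem IsPhase.step (h : IsPhase E c F J₀ J) (hF : IsSTCrossing S T F) (hE : E ⊆ S ×ˢ T)
    (hc : ∀ e ∈ E, 0 ≤ c e) {C : Finset (Fin n)}
    (hC : IsCore (uncovered F J₀) C) (hJ : J ⊆ J') (hsub : J' \ J ⊆ E)
    (hcov : IsEdgeCover J' (halo (uncovered F J₀) C))
    (hcost : ∀ x, IsFractionalCover E (halo (uncovered F J₀) C) x → ∑ e ∈ J' \ J, c e ≤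
        ∑ e ∈ E with ∃ X ∈ uncovered (halo (uncovered F J₀) C) J, Covers e X, c e * x e) :
    IsPhase E c F J₀ J' where
  subset := h.subset.trans hJ
  sdiff_subset e he := by
    by_cases h' : e ∈ J
    · exact h.sdiff_subset (Finset.mem_sdiff.2 ⟨h', (Finset.mem_sdiff.1 he).2⟩)
    · exact hsub (Finset.mem_sdiff.2 ⟨(Finset.mem_sdiff.1 he).1, h'⟩)
  cost_le x hx := by
    have hsplit : ∑ e ∈ J' \ J₀, c e = ∑ e ∈ J \ J₀, c e + ∑ e ∈ J' \ J, c e := by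
      rw [← Finset.sum_union]
      · refine Finset.sum_congr ?_ fun _ _ => rfl
        ext e
        have h1 := @h.subset e
        have h2 := @hJ e
        simp only [Finset.mem_sdiff, Finset.mem_union]
        tauto
      · rw [Finset.disjoint_left]
        intro e he he'
        exact (Finset.mem_sdiff.1 he').2 (Finset.mem_sdiff.1 he).1
    have hx' : IsFractionalCover E (halo (uncovered F J₀) C) x := hx.mono fun X hX => hX.1.1
    rw [hsplit]
    refine (add_le_add (h.cost_le x hx) (hcost x hx')).trans ?_
    rw [← Finset.sum_union]
    · refine Finset.sum_le_sum_of_subset_of_nonneg ?_ fun e he _ => ?_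
      · intro e he
        simp only [charged, Finset.mem_union, Finset.mem_filter] at he ⊢
        rcases he with ⟨h1, D, h2, h3, h4⟩ | ⟨h1, X, h2, h3⟩
        · exact ⟨h1, D, h2, h3.mono hJ, h4⟩
        · exact ⟨h1, C, hC, hcov, X, h2.1, h3⟩
      · have := (Finset.mem_filter.1 he).1
        exact mul_nonneg (hc e this) (hx.2 e this)
    · rw [Finset.disjoint_left]
      intro e he he'
      simp only [charged, Finset.mem_filter] at he he'
      obtain ⟨h1, D, h2, h3, Y, hY, h4⟩ := he
      obtain ⟨-, X, hX, h5⟩ := he'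
      have := eq_of_covers_halo (hF.uncovered J₀) hY hX.1 (hE h1) h4 h5
      subst this
      obtain ⟨f, hf, hfX⟩ := h3 X hX.1
      exact hX.2 f hf hfX

/-- The state of affairs after `p` phases. -/
def IsProgress (T : Finset (Fin n)) (E : Finset (Fin n × Fin n)) (c : Fin n × Fin n → ℝ)
    (F : Set (Finset (Fin n))) (p : ℕ) (J : Finset (Fin n × Fin n)) : Prop :=
  J ⊆ E ∧ ∃ q ≤ p, (∀ x, IsFractionalCover E F x → ∑ e ∈ J, c e ≤ q * ∑ e ∈ E, c e * x e) ∧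
    (∀ t ∈ T, 2 ^ q * (coresAvoiding (uncovered F J) t).card ≤ n) ∧
    (q < p → uncovered F J = ∅) ∧ (q = 0 ∨ F.Nonempty ∧ q ≤ Nat.log 2 n + 1)

theorem isProgress_zero (hF : IsSTCrossing S T F) (hP : IsProper S T F) :
    IsProgress T E c F 0 ∅ :=
  ⟨Finset.empty_subset _, 0, le_rfl, by simp, fun t ht => by
    simpa using card_coresAvoiding_le (hF.uncovered ∅) (hP.uncovered ∅) ht, by simp, by simp⟩

theorem uncovered_uncovered (h : J ⊆ J') : uncovered (uncovered F J) J' = uncovered F J' :=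
  Set.ext fun _ => ⟨fun hX => ⟨hX.1.1, hX.2⟩, fun hX => ⟨uncovered_antitone h hX, hX.2⟩⟩

/-- Here `q` counts the phases that began with something uncovered. Such a phase adds one LP value
to the cost and one factor two to the core bound; any other phase costs at most zero and leaves `q`
unchanged. -/
theorem IsProgress.step {p : ℕ} (h : IsProgress T E c F p J) (hF : IsSTCrossing S T F)
    (hP : IsProper S T F) (hc : ∀ e ∈ E, 0 ≤ c e) (hph : IsPhase E c F J J')
    (hcov : ∀ C, IsCore (uncovered F J) C → IsEdgeCover J' (halo (uncovered F J) C)) :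
    IsProgress T E c F (p + 1) J' := by
  obtain ⟨hJ, q, hq, hcost, hcard, hlt, hlog⟩ := h
  have hJ' : J' ⊆ E := fun e he => by
    by_cases h' : e ∈ J
    · exact hJ h'
    · exact hph.sdiff_subset (Finset.mem_sdiff.2 ⟨he, h'⟩)
  have hsum : ∑ e ∈ J', c e = ∑ e ∈ J' \ J, c e + ∑ e ∈ J, c e :=
    (Finset.sum_sdiff hph.subset).symm
  have hhalf : ∀ t ∈ T, 2 * (coresAvoiding (uncovered F J') t).card ≤
      (coresAvoiding (uncovered F J) t).card := fun t ht => by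
    have := two_mul_card_coresAvoiding_le (hF.uncovered J) (hP.uncovered J) hcov ht
    rwa [uncovered_uncovered hph.subset] at this
  refine ⟨hJ', ?_⟩
  by_cases hemp : uncovered F J = ∅
  · refine ⟨q, by omega, fun x hx => ?_, fun t ht => ?_, fun _ => ?_, hlog⟩
    · have h1 := hph.cost_le x hx
      -- Without uncovered sets there are no cores, hence nothing is charged.
      have h2 : charged E (uncovered F J) J' = ∅ := by
        rw [Finset.eq_empty_iff_forall_notMem]
        intro e he
        obtain ⟨-, C, hC, -⟩ := mem_charged.1 he
        simpa [hemp] using hC.1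
      rw [h2, Finset.sum_empty] at h1
      linarith [hcost x hx]
    · refine le_trans (Nat.mul_le_mul_left _ ?_) (hcard t ht)
      linarith [hhalf t ht]
    · exact Set.subset_empty_iff.1 ((uncovered_antitone hph.subset).trans hemp.subset)
  · have hqp : q = p := by
      by_contra hne
      exact hemp (hlt (by omega))
    refine ⟨q + 1, by omega, fun x hx => ?_, fun t ht => ?_, by omega, Or.inr ⟨?_, ?_⟩⟩
    · have h1 := hph.cost_le x hx
      have h2 : ∑ e ∈ charged E (uncovered F J) J', c e * x e ≤ ∑ e ∈ E, c e * x e :=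
        Finset.sum_le_sum_of_subset_of_nonneg (fun e he => (mem_charged.1 he).1)
          fun e he _ => mul_nonneg (hc e he) (hx.2 e he)
      push_cast
      linarith [hcost x hx]
    · calc 2 ^ (q + 1) * (coresAvoiding (uncovered F J') t).card
          = 2 ^ q * (2 * (coresAvoiding (uncovered F J') t).card) := by ring
        _ ≤ 2 ^ q * (coresAvoiding (uncovered F J) t).card := Nat.mul_le_mul_left _ (hhalf t ht)
        _ ≤ n := hcard t ht
    · exact (Set.nonempty_iff_ne_empty.2 hemp).mono fun X hX => hX.1
    · have : ∃ t ∈ T, (coresAvoiding (uncovered F J) t).card ≠ 0 := by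
        by_contra! h'
        exact hemp (eq_empty_of_coresAvoiding (hP.uncovered J) h')
      obtain ⟨t, ht, h'⟩ := this
      -- A remaining core that avoids `t` bounds the number of productive phases so far by the
      -- binary logarithm of `n`.
      have h1 : 2 ^ q ≤ n :=
        (Nat.le_mul_of_pos_right _ (Nat.pos_of_ne_zero h')).trans (hcard t ht)
      have hn : n ≠ 0 := fun h => by
        rw [h] at t
        exact t.elim0
      exact Nat.succ_le_succ ((Nat.le_log_iff_pow_le one_lt_two hn).2 h1)

/-- Running `n` phases avoids computing a logarithm: either the family was exhausted early, or the
core counts are below `n / 2 ^ n < 1`. -/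
theorem IsProgress.isEdgeCover (h : IsProgress T E c F n J) (hP : IsProper S T F) :
    IsEdgeCover J F := by
  obtain ⟨-, q, hq, -, hcard, hlt, -⟩ := h
  rw [isEdgeCover_iff_uncovered]
  rcases hq.lt_or_eq with hq | rfl
  · exact hlt hq
  · refine eq_empty_of_coresAvoiding (hP.uncovered J) fun t ht => ?_
    by_contra h'
    have h1 := (Nat.le_mul_of_pos_right _ (Nat.pos_of_ne_zero h')).trans (hcard t ht)
    exact absurd (Nat.lt_two_pow_self (n := q)) (by omega)

theorem le_mul_lpValue (hE : IsEdgeCover E F) {a z : ℝ} (ha : 0 ≤ a)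
    (h : ∀ x, IsFractionalCover E F x → z ≤ a * ∑ e ∈ E, c e * x e) :
    z ≤ a * lpValue E c F := by
  classical
  have hone : IsFractionalCover E F 1 := by
    refine ⟨fun X hX => ?_, fun e _ => zero_le_one⟩
    obtain ⟨e, he, heX⟩ := hE X hX
    have h1 : e ∈ E.filter (fun e => Covers e X) := Finset.mem_filter.2 ⟨he, heX⟩
    have h2 : (1 : ℝ) ≤ ((E.filter fun e => Covers e X).card : ℝ) := by
      exact_mod_cast Finset.card_pos.2 ⟨e, h1⟩
    simpa using h2
  -- For `a = 0` one cannot divide, and the all-ones cover gives `z ≤ 0` directly. It also shows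
  -- that the infimum is over a nonempty set.
  rcases ha.eq_or_lt with rfl | ha
  · simpa using h 1 hone
  · rw [← div_le_iff₀' ha]
    refine le_csInf ⟨_, 1, hone, rfl⟩ ?_
    rintro _ ⟨x, hx, rfl⟩
    rw [div_le_iff₀' ha]
    exact h x hx

/-- A productive phase requires `n ≥ 2`, since a member contains one node and misses another. Then
the extra `1` in `Nat.log 2 n + 1` is at most `log n / log 2`, whence the factor 2 in the constant.
-/
theorem IsProgress.cost_le {p : ℕ} (h : IsProgress T E c F p J) (hP : IsProper S T F)
    (hE : IsEdgeCover E F) (hc : ∀ e ∈ E, 0 ≤ c e) :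
    ∑ e ∈ J, c e ≤ 2 / Real.log 2 * Real.log n * lpValue E c F := by
  obtain ⟨-, q, -, hcost, -, -, hlog⟩ := h
  have hlog2 := Real.log_pos one_lt_two
  have hlogn : 0 ≤ Real.log n := Real.log_natCast_nonneg n
  have ha : 0 ≤ 2 / Real.log 2 * Real.log n := by positivity
  refine le_mul_lpValue hE ha fun x hx => (hcost x hx).trans ?_
  refine mul_le_mul_of_nonneg_right ?_ (Finset.sum_nonneg fun e he =>
    mul_nonneg (hc e he) (hx.2 e he))
  rcases hlog with rfl | ⟨⟨X, hX⟩, hq⟩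
  · simpa using ha
  · obtain ⟨⟨s, -, hs⟩, t, -, ht⟩ := hP X hX
    have hn : 2 ≤ n := by
      have h1 : s ≠ t := fun h => ht (h ▸ hs)
      have h2 : (s : ℕ) ≠ t := fun h => h1 (Fin.ext h)
      omega
    have h1 : Real.log 2 ≤ Real.log n := Real.log_le_log two_pos (by exact_mod_cast hn)
    have h2 : (Nat.log 2 n : ℝ) * Real.log 2 ≤ Real.log n := by
      rw [← Real.log_pow]
      refine Real.log_le_log (by positivity) ?_
      exact_mod_cast Nat.pow_log_le_self 2 (by omega)
    have h3 : (q : ℝ) ≤ Nat.log 2 n + 1 := by exact_mod_cast hq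
    rw [div_mul_eq_mul_div, le_div_iff₀ hlog2]
    nlinarith

end

section

/-! ### Programs with bounded loops -/

namespace State

def setReg (s : State) (x z : ℕ) : State := { s with reg := Function.update s.reg x z }

def setArr (s : State) (a i j z : ℕ) : State := { s with arr := updateEntry s.arr a i j z }

def setCostReg (s : State) (x : ℕ) (z : ℝ) : State :=
  { s with costReg := Function.update s.costReg x z }

def setCostArr (s : State) (a i j : ℕ) (z : ℝ) : State :=
  { s with costArr := updateEntry s.costArr a i j z }

variable (s : State) (a i j x y z : ℕ) (w : ℝ) (o : Option (ℕ → ℕ))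

@[simp] theorem setReg_reg : (s.setReg x z).reg y = if y = x then z else s.reg y := by
  simp [setReg, Function.update_apply]
@[simp] theorem setReg_arr : (s.setReg x z).arr = s.arr := rfl
@[simp] theorem setReg_costReg : (s.setReg x z).costReg = s.costReg := rfl
@[simp] theorem setReg_costArr : (s.setReg x z).costArr = s.costArr := rfl
@[simp] theorem setArr_reg : (s.setArr a i j z).reg = s.reg := rfl
@[simp] theorem setArr_costArr : (s.setArr a i j z).costArr = s.costArr := rfl
@[simp] theorem setCostReg_reg : (s.setCostReg x w).reg = s.reg := rfl
@[simp] theorem setCostReg_costReg :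
    (s.setCostReg x w).costReg y = if y = x then w else s.costReg y := by
  simp [setCostReg, Function.update_apply]
@[simp] theorem answer_costReg : (s.answer x y z o).costReg = s.costReg := by cases o <;> rfl
@[simp] theorem answer_costArr : (s.answer x y z o).costArr = s.costArr := by cases o <;> rfl

theorem updateEntry_of_ne {α : Type} (m : ℕ → ℕ → ℕ → α) {a b : ℕ} (h : b ≠ a) (i j : ℕ) (w : α) :
    updateEntry m a i j w b = m b := Function.update_of_ne h _ _

theorem updateEntry_apply {α : Type} (m : ℕ → ℕ → ℕ → α) (a i j : ℕ) (w : α) (b k l : ℕ) :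
    updateEntry m a i j w b k l = if b = a ∧ k = i ∧ l = j then w else m b k l := by
  unfold updateEntry
  by_cases h1 : b = a
  · subst h1
    by_cases h2 : k = i
    · subst h2
      by_cases h3 : l = j
      · simp [h3]
      · simp [h3]
    · simp [h2]
  · simp [h1]

theorem setArr_arr_of_ne {b : ℕ} (h : b ≠ a) : (s.setArr a i j z).arr b = s.arr b :=
  updateEntry_of_ne _ h _ _ _

theorem setArr_arr (b k l : ℕ) :
    (s.setArr a i j z).arr b k l = if b = a ∧ k = i ∧ l = j then z else s.arr b k l :=
  updateEntry_apply _ _ _ _ _ _ _ _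

theorem setCostArr_costArr_of_ne {b : ℕ} (h : b ≠ a) :
    (s.setCostArr a i j w).costArr b = s.costArr b :=
  updateEntry_of_ne _ h _ _ _

theorem setCostArr_costArr (b k l : ℕ) : (s.setCostArr a i j w).costArr b k l =
    if b = a ∧ k = i ∧ l = j then w else s.costArr b k l :=
  updateEntry_apply _ _ _ _ _ _ _ _

theorem answer_reg : (s.answer x a i o).reg y =
    if y = x then (if o.isSome then 1 else 0) else s.reg y := by
  cases o <;> simp [answer, Function.update_apply]

theorem answer_arr_of_ne {b : ℕ} (h : b ≠ a) : (s.answer x a i o).arr b = s.arr b := by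
  cases o
  · rfl
  · exact Function.update_of_ne h _ _

theorem answer_none_arr : (s.answer x a i none).arr = s.arr := rfl

theorem answer_some_arr (f : ℕ → ℕ) : (s.answer x a i (some f)).arr a i = f := by
  simp [answer, updateRow]

end State

/-- Structured programs: all loops are bounded. `forTo x r p` performs `p` with the values
`0, 1, …, m - 1` of the variable `x`, where `m` is the value of the variable `r`. -/
inductive Cmd where
  | skip
  | setReg (x : ℕ) (e : NatExpr)
  | setArr (a : ℕ) (i j e : NatExpr)
  | setCostReg (x : ℕ) (e : CostExpr)
  | setCostArr (a : ℕ) (i j : NatExpr) (e : CostExpr)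
  | query (co : Bool) (a : ℕ) (u v : NatExpr) (x : ℕ) (b : ℕ) (k : NatExpr)
  | seq (p q : Cmd)
  | cond (b : Test) (p q : Cmd)
  | forTo (x r : ℕ) (p : Cmd)

/-- The states at the beginnings of the rounds of a loop. -/
def loopState (f : State → State) (x : ℕ) (s : State) : ℕ → State
  | 0 => s.setReg x 0
  | k + 1 => (f (loopState f x s k)).setReg x (k + 1)

namespace Cmd

def compile : Cmd → Program
  | skip => .skip
  | setReg x e => .setReg x e
  | setArr a i j e => .setArr a i j e
  | setCostReg x e => .setCostReg x e
  | setCostArr a i j e => .setCostArr a i j e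
  | query co a u v x b k => .query co a u v x b k
  | seq p q => .seq p.compile q.compile
  | cond b p q => .cond b p.compile q.compile
  | forTo x r p => .seq (.setReg x (.const 0))
      (.loop (.natLe (.add (.reg x) (.const 1)) (.reg r))
        (.seq p.compile (.setReg x (.add (.reg x) (.const 1)))))

open Classical in
/-- The effect of a structured program. -/
def exec (O : Oracle) : Cmd → State → State
  | skip, s => s
  | setReg x e, s => s.setReg x (e.eval s)
  | setArr a i j e, s => s.setArr a (i.eval s) (j.eval s) (e.eval s)
  | setCostReg x e, s => s.setCostReg x (e.eval s)
  | setCostArr a i j e, s => s.setCostArr a (i.eval s) (j.eval s) (e.eval s)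
  | query co a u v x b k, s =>
      s.answer x b (k.eval s) (O co (s.arr a) (u.eval s) (v.eval s))
  | seq p q, s => q.exec O (p.exec O s)
  | cond b p q, s => if b.Holds s then p.exec O s else q.exec O s
  | forTo x r p, s => loopState (p.exec O) x s (s.reg r)

theorem exec_seq (O : Oracle) (p q : Cmd) (s : State) :
    (seq p q).exec O s = q.exec O (p.exec O s) := rfl

theorem exec_cond_pos {O : Oracle} {b : Test} {s : State} (h : b.Holds s) (p q : Cmd) :
    (cond b p q).exec O s = p.exec O s := if_pos h

theorem exec_cond_neg {O : Oracle} {b : Test} {s : State} (h : ¬ b.Holds s) (p q : Cmd) :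
    (cond b p q).exec O s = q.exec O s := if_neg h

/-- The variables that may be changed. -/
def regs : Cmd → List ℕ
  | setReg x _ => [x]
  | query _ _ _ _ x _ _ => [x]
  | seq p q => p.regs ++ q.regs
  | cond _ p q => p.regs ++ q.regs
  | forTo x _ p => x :: p.regs
  | _ => []

/-- The arrays that may be changed. -/
def arrs : Cmd → List ℕ
  | setArr a _ _ _ => [a]
  | query _ _ _ _ _ b _ => [b]
  | seq p q => p.arrs ++ q.arrs
  | cond _ p q => p.arrs ++ q.arrs
  | forTo _ _ p => p.arrs
  | _ => []

/-- The cost variables that may be changed. -/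
def costRegs : Cmd → List ℕ
  | setCostReg x _ => [x]
  | seq p q => p.costRegs ++ q.costRegs
  | cond _ p q => p.costRegs ++ q.costRegs
  | forTo _ _ p => p.costRegs
  | _ => []

/-- The cost arrays that may be changed. -/
def costArrs : Cmd → List ℕ
  | setCostArr a _ _ _ => [a]
  | seq p q => p.costArrs ++ q.costArrs
  | cond _ p q => p.costArrs ++ q.costArrs
  | forTo _ _ p => p.costArrs
  | _ => []

/-- `s'` differs from `s` only in what `c` may change. -/
structure Frame (c : Cmd) (s s' : State) : Prop where
  reg : ∀ x, x ∉ c.regs → s'.reg x = s.reg x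
  arr : ∀ a, a ∉ c.arrs → s'.arr a = s.arr a
  costReg : ∀ x, x ∉ c.costRegs → s'.costReg x = s.costReg x
  costArr : ∀ a, a ∉ c.costArrs → s'.costArr a = s.costArr a

theorem Frame.refl (c : Cmd) (s : State) : Frame c s s :=
  ⟨fun _ _ => rfl, fun _ _ => rfl, fun _ _ => rfl, fun _ _ => rfl⟩

theorem Frame.trans {c : Cmd} {s s' s'' : State} (h : Frame c s s') (h' : Frame c s' s'') :
    Frame c s s'' :=
  ⟨fun x hx => (h'.reg x hx).trans (h.reg x hx), fun x hx => (h'.arr x hx).trans (h.arr x hx),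
    fun x hx => (h'.costReg x hx).trans (h.costReg x hx),
    fun x hx => (h'.costArr x hx).trans (h.costArr x hx)⟩

theorem Frame.weaken {c d : Cmd} {s s' : State} (h : Frame c s s') (h1 : c.regs ⊆ d.regs)
    (h2 : c.arrs ⊆ d.arrs) (h3 : c.costRegs ⊆ d.costRegs) (h4 : c.costArrs ⊆ d.costArrs) :
    Frame d s s' :=
  ⟨fun x hx => h.reg x fun h => hx (h1 h), fun x hx => h.arr x fun h => hx (h2 h),
    fun x hx => h.costReg x fun h => hx (h3 h), fun x hx => h.costArr x fun h => hx (h4 h)⟩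

theorem Frame.setReg {c : Cmd} {s s' : State} (h : Frame c s s') {x : ℕ} (hx : x ∈ c.regs)
    (z : ℕ) : Frame c s (s'.setReg x z) :=
  ⟨fun y hy => by
    have hne : y ≠ x := fun e => hy (e ▸ hx)
    rw [State.setReg_reg, if_neg hne, h.reg y hy], h.arr, h.costReg, h.costArr⟩

theorem frame_loopState {O : Oracle} {c : Cmd} (hc : ∀ s, Frame c s (c.exec O s)) (x r : ℕ)
    (s : State) (k : ℕ) : Frame (forTo x r c) s (loopState (c.exec O) x s k) := by
  induction k with
  | zero => exact (Frame.refl _ _).setReg (by simp [regs]) _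
  | succ m ih =>
    refine Frame.setReg (ih.trans ((hc _).weaken ?_ ?_ ?_ ?_)) (by simp [regs]) _
    all_goals simp [regs, arrs, costRegs, costArrs]

/-- This settles all non-interference questions: since the variables and arrays a command may write
are computed from its syntax, each later preservation fact reduces to a list membership closed by
`decide`. -/
theorem frame_exec (O : Oracle) (c : Cmd) (s : State) : Frame c s (c.exec O s) := by
  induction c generalizing s with
  | skip => exact Frame.refl _ _
  | setReg x e => exact (Frame.refl _ _).setReg (by simp [regs]) _
  | setArr a i j e =>
    exact ⟨fun _ _ => rfl, fun b hb => State.setArr_arr_of_ne _ _ _ _ _ (by simpa [arrs] using hb),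
      fun _ _ => rfl, fun _ _ => rfl⟩
  | setCostReg x e =>
    refine ⟨fun _ _ => rfl, fun b hb => rfl, fun y hy => ?_, fun _ _ => rfl⟩
    simp only [costRegs, List.mem_singleton] at hy
    simp [exec, hy]
  | setCostArr a i j e =>
    exact ⟨fun _ _ => rfl, fun _ _ => rfl, fun _ _ => rfl,
      fun b hb => State.setCostArr_costArr_of_ne _ _ _ _ _ (by simpa [costArrs] using hb)⟩
  | query co a u v x b k =>
    refine ⟨fun y hy => ?_, fun d hd =>
      State.answer_arr_of_ne _ _ _ _ _ (by simpa [arrs] using hd), fun _ _ => ?_, fun _ _ => ?_⟩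
    · simp only [regs, List.mem_singleton] at hy
      simp [exec, State.answer_reg, hy]
    · simp [exec]
    · simp [exec]
  | seq p q ihp ihq =>
    exact ((ihp s).weaken (by simp [regs]) (by simp [arrs]) (by simp [costRegs])
      (by simp [costArrs])).trans ((ihq _).weaken (by simp [regs]) (by simp [arrs])
        (by simp [costRegs]) (by simp [costArrs]))
  | cond b p q ihp ihq =>
    rw [exec]
    split_ifs
    · exact (ihp s).weaken (by simp [regs]) (by simp [arrs]) (by simp [costRegs])
        (by simp [costArrs])
    · exact (ihq s).weaken (by simp [regs]) (by simp [arrs]) (by simp [costRegs])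
        (by simp [costArrs])
  | forTo x r p ih => exact frame_loopState ih x r s _

/-- The bounds of all loops are in variables from `R`, which are never changed, and no loop changes
its own counter. -/
def wellFormed (R : List ℕ) : Cmd → Bool
  | setReg x _ => !R.contains x
  | query _ _ _ _ x _ _ => !R.contains x
  | seq p q => p.wellFormed R && q.wellFormed R
  | cond _ p q => p.wellFormed R && q.wellFormed R
  | forTo x r p => R.contains r && !R.contains x && !p.regs.contains x && p.wellFormed R
  | _ => true

/-- A bound on the number of steps in terms of a bound on the variables that bound the loops. -/
def time : Cmd → Polynomial ℕ
  | seq p q => p.time + q.time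
  | cond _ p q => p.time + q.time + 1
  | forTo _ _ p => Polynomial.X * (p.time + 2) + 2
  | _ => 1

theorem notMem_regs_of_wellFormed {R : List ℕ} {c : Cmd} (h : c.wellFormed R) :
    ∀ r ∈ R, r ∉ c.regs := by
  induction c with
  | setReg x e =>
    intro r hr
    simp only [wellFormed, Bool.not_eq_true', List.contains_eq_mem, decide_eq_false_iff_not] at h
    simp only [regs, List.mem_singleton]
    rintro rfl
    exact h hr
  | query co a u v x b k =>
    intro r hr
    simp only [wellFormed, Bool.not_eq_true', List.contains_eq_mem, decide_eq_false_iff_not] at h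
    simp only [regs, List.mem_singleton]
    rintro rfl
    exact h hr
  | seq p q ihp ihq =>
    simp only [wellFormed, Bool.and_eq_true] at h
    intro r hr
    simp only [regs, List.mem_append, not_or]
    exact ⟨ihp h.1 r hr, ihq h.2 r hr⟩
  | cond b p q ihp ihq =>
    simp only [wellFormed, Bool.and_eq_true] at h
    intro r hr
    simp only [regs, List.mem_append, not_or]
    exact ⟨ihp h.1 r hr, ihq h.2 r hr⟩
  | forTo x r' p ih =>
    simp only [wellFormed, Bool.and_eq_true, Bool.not_eq_true', List.contains_eq_mem,
      decide_eq_false_iff_not] at h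
    intro r hr
    simp only [regs, List.mem_cons, not_or]
    exact ⟨fun e => h.1.1.2 (e ▸ hr), ih h.2 r hr⟩
  | _ => simp [regs]

theorem loopState_reg {O : Oracle} {x : ℕ} {c : Cmd} (s : State) (k : ℕ) :
    (loopState (c.exec O) x s k).reg x = k := by
  cases k <;> simp [loopState]

/-- Well-formedness fixes the number of rounds of a loop on entry, because the body touches neither
the bound nor the counter. The time bound therefore needs no information about the family or the
answers. -/
theorem runs_exec (O : Oracle) {R : List ℕ} {B : ℕ} {c : Cmd} (hc : c.wellFormed R) (s : State)
    (hs : ∀ r ∈ R, s.reg r ≤ B) :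
    ∃ t ≤ c.time.eval B, Runs O c.compile s t (c.exec O s) := by
  induction c generalizing s with
  | skip => exact ⟨1, by simp [time], .skip s⟩
  | setReg x e => exact ⟨1, by simp [time], .setReg s x e⟩
  | setArr a i j e => exact ⟨1, by simp [time], .setArr s a i j e⟩
  | setCostReg x e => exact ⟨1, by simp [time], .setCostReg s x e⟩
  | setCostArr a i j e => exact ⟨1, by simp [time], .setCostArr s a i j e⟩
  | query co a u v x b k => exact ⟨1, by simp [time], .query s co a u v x b k⟩
  | seq p q ihp ihq =>
    simp only [wellFormed, Bool.and_eq_true] at hc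
    obtain ⟨t, ht, hr⟩ := ihp hc.1 s hs
    obtain ⟨t', ht', hr'⟩ := ihq hc.2 (p.exec O s) fun r hr => by
      rw [(frame_exec O p s).reg r (notMem_regs_of_wellFormed hc.1 r hr)]
      exact hs r hr
    exact ⟨t + t', by simp only [time, Polynomial.eval_add]; omega, .seq hr hr'⟩
  | cond b p q ihp ihq =>
    simp only [wellFormed, Bool.and_eq_true] at hc
    rw [exec]
    split_ifs with hb
    · obtain ⟨t, ht, hr⟩ := ihp hc.1 s hs
      exact ⟨t + 1, by simp only [time, Polynomial.eval_add, Polynomial.eval_one]; omega,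
        .condTrue hb hr⟩
    · obtain ⟨t, ht, hr⟩ := ihq hc.2 s hs
      exact ⟨t + 1, by simp only [time, Polynomial.eval_add, Polynomial.eval_one]; omega,
        .condFalse hb hr⟩
  | forTo x r p ih =>
    have hreg := notMem_regs_of_wellFormed hc
    simp only [wellFormed, Bool.and_eq_true, Bool.not_eq_true', List.contains_eq_mem,
      decide_eq_false_iff_not, decide_eq_true_eq] at hc
    obtain ⟨⟨⟨hrR, hxR⟩, hxp⟩, hp⟩ := hc
    have hfr := fun k => frame_loopState (frame_exec O p) x r s k
    set σ := loopState (p.exec O) x s with hσ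
    have hloop : ∀ d k, k + d = s.reg r → ∃ t ≤ d * (p.time.eval B + 2) + 1,
        Runs O (.loop (.natLe (.add (.reg x) (.const 1)) (.reg r))
          (.seq p.compile (.setReg x (.add (.reg x) (.const 1))))) (σ k) t (σ (s.reg r)) := by
      intro d
      induction d with
      | zero =>
        intro k hk
        rw [Nat.add_zero] at hk
        refine ⟨1, by omega, hk ▸ .loopDone ?_⟩
        simp only [Test.Holds, NatExpr.eval]
        rw [(hfr k).reg r (hreg r hrR), hσ, loopState_reg]
        omega
      | succ d ihd =>
        intro k hk
        obtain ⟨t, ht, hr⟩ := ih hp (σ k) fun r' hr' => by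
          rw [(hfr k).reg r' (hreg r' hr')]
          exact hs r' hr'
        obtain ⟨t', ht', hr'⟩ := ihd (k + 1) (by omega)
        -- The machine increments the counter while `loopState` assigns `k + 1`; they agree because
        -- the body leaves the counter alone.
        have hstep : σ (k + 1) =
            { p.exec O (σ k) with
              reg := Function.update (p.exec O (σ k)).reg x
                ((NatExpr.add (.reg x) (.const 1)).eval (p.exec O (σ k))) } := by
          simp only [NatExpr.eval]
          rw [(frame_exec O p (σ k)).reg x hxp, hσ, loopState_reg]
          rfl
        refine ⟨t + 1 + t' + 1, ?_, .loopStep ?_ (.seq hr (.setReg _ _ _)) (hstep ▸ hr')⟩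
        · rw [Nat.add_mul]
          omega
        · simp only [Test.Holds, NatExpr.eval]
          rw [(hfr k).reg r (hreg r hrR), hσ, loopState_reg]
          omega
    obtain ⟨t, ht, hr⟩ := hloop (s.reg r) 0 (by omega)
    refine ⟨1 + t, ?_, .seq (.setReg s x _) hr⟩
    have h1 := Nat.mul_le_mul_right (p.time.eval B + 2) (hs r hrR)
    simp only [time, Polynomial.eval_add, Polynomial.eval_mul, Polynomial.eval_X,
      Polynomial.eval_ofNat]
    omega

/-- Loop invariants. -/
theorem exec_forTo_induct {O : Oracle} {x r m : ℕ} {c : Cmd} {s : State} (P : ℕ → State → Prop)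
    (hm : s.reg r = m) (h0 : P 0 (s.setReg x 0))
    (hstep : ∀ k < m, ∀ s', s'.reg x = k → Frame (forTo x r c) s s' → P k s' →
      P (k + 1) ((c.exec O s').setReg x (k + 1))) :
    P m ((forTo x r c).exec O s) := by
  have : ∀ k ≤ m, P k (loopState (c.exec O) x s k) := by
    intro k
    induction k with
    | zero => exact fun _ => h0
    | succ k ih =>
      exact fun hk => hstep k hk _ (loopState_reg s k) (frame_loopState (frame_exec O c) x r s k)
        (ih (by omega))
  rw [exec, hm]
  exact this m le_rfl

/-- Two nested loops whose rounds establish independent facts `Q i j`, under an invariant `I`. -/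
theorem exec_forTo_forall₂ {O : Oracle} {x y r m : ℕ} {c : Cmd} {s : State}
    (I : State → Prop) (Q : ℕ → ℕ → State → Prop) (hm : s.reg r = m)
    (hr : r ∉ (forTo x r (forTo y r c)).regs) (hx : x ∉ (forTo y r c).regs)
    (hI : ∀ s k, (I s → I (s.setReg x k)) ∧ (I s → I (s.setReg y k)))
    (hQ : ∀ s k i j, (Q i j s → Q i j (s.setReg x k)) ∧ (Q i j s → Q i j (s.setReg y k)))
    (h0 : I s)
    (hstep : ∀ i < m, ∀ j < m, ∀ s', s'.reg x = i → s'.reg y = j →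
      Frame (forTo x r (forTo y r c)) s s' → I s' →
        I (c.exec O s') ∧ Q i j (c.exec O s') ∧
          ∀ i' j', Q i' j' s' → (i', j') ≠ (i, j) → Q i' j' (c.exec O s')) :
    I ((forTo x r (forTo y r c)).exec O s) ∧
      ∀ i < m, ∀ j < m, Q i j ((forTo x r (forTo y r c)).exec O s) := by
  refine exec_forTo_induct (fun k s' => I s' ∧ ∀ i < k, ∀ j < m, Q i j s') hm
    ⟨(hI _ _).1 h0, by simp⟩ ?_
  rintro i hi s₁ hxi hfr₁ ⟨hI₁, hQ₁⟩
  have hm₁ : s₁.reg r = m := by rw [hfr₁.reg r hr, hm]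
  have key := exec_forTo_induct (O := O) (c := c) (x := y)
    (fun k s' => I s' ∧ (∀ i' < i, ∀ j < m, Q i' j s') ∧ ∀ j < k, Q i j s') hm₁
    ⟨(hI _ _).2 hI₁, fun i' hi' j hj => (hQ _ _ _ _).2 (hQ₁ i' hi' j hj), by simp⟩ (by
      rintro j hj s₂ hyj hfr₂ ⟨hI₂, hQ₂, hQ₂'⟩
      have hxi₂ : s₂.reg x = i := by rw [hfr₂.reg x hx, hxi]
      obtain ⟨h1, h2, h3⟩ := hstep i hi j hj s₂ hxi₂ hyj (hfr₁.trans (hfr₂.weaken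
        (by simp [regs]) (by simp [arrs]) (by simp [costRegs]) (by simp [costArrs]))) hI₂
      refine ⟨(hI _ _).2 h1, fun i' hi' j' hj' => (hQ _ _ _ _).2
        (h3 i' j' (hQ₂ i' hi' j' hj') ?_), fun j' hj' => (hQ _ _ _ _).2 ?_⟩
      · intro h
        rw [Prod.mk.injEq] at h
        omega
      · rcases (Nat.lt_succ_iff.1 hj').lt_or_eq with hj' | rfl
        · refine h3 i j' (hQ₂' j' hj') fun h => ?_
          rw [Prod.mk.injEq] at h
          omega
        · exact h2)
  refine ⟨(hI _ _).1 key.1, fun i' hi' j hj => (hQ _ _ _ _).1 ?_⟩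
  rcases (Nat.lt_succ_iff.1 hi').lt_or_eq with hi' | rfl
  · exact key.2.1 i' hi' j hj
  · exact key.2.2 j hj

end Cmd

end

section

/-! ### The program -/

namespace Cmd

/-- The test whether the value of an expression is nonzero. -/
def nonzero (e : NatExpr) : Test := .natLe (.const 1) e

theorem nonzero_holds {s : State} {e : NatExpr} : (nonzero e).Holds s ↔ e.eval s ≠ 0 :=
  Nat.one_le_iff_ne_zero

/-- Run through all pairs of nodes. -/
abbrev forPairs (x y : ℕ) (c : Cmd) : Cmd := forTo x 0 (forTo y 0 c)

/-- Put the edges of array `2`, and the edges of array `8` that enter the node in variable `6`,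
into array `11`. -/
def buildQuery : Cmd :=
  seq (forPairs 7 8 (setArr 11 (.reg 7) (.reg 8) (.arr 2 (.reg 7) (.reg 8))))
    (forTo 7 0 (cond (nonzero (.arr 8 (.reg 7) (.reg 6)))
      (setArr 11 (.reg 7) (.reg 6) (.const 1)) skip))

/-- Find a largest uncovered member of the halo of the core in row `0` of array `7`; its complement
is put into row `0` of array `10`, and variable `12` tells whether there is one. -/
def scan : Cmd :=
  seq (setReg 12 (.const 0))
    (seq (forTo 6 0 (setArr 10 (.const 0) (.reg 6) (.const 1)))
      (forTo 6 0 (cond (.and (nonzero (.arr 10 (.const 0) (.reg 6)))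
          (.neg (nonzero (.arr 7 (.const 0) (.reg 6)))))
        (seq buildQuery (seq (query true 11 (.reg 3) (.reg 6) 10 10 (.const 0))
          (cond (nonzero (.reg 10)) (setReg 12 (.const 1)) skip))) skip)))

/-- The test whether the pair in the variables `7` and `8` leaves the set found. -/
def leaves : Test :=
  .and (.neg (nonzero (.arr 10 (.const 0) (.reg 7)))) (nonzero (.arr 10 (.const 0) (.reg 8)))

/-- Find an edge of least reduced cost that leaves the set found. -/
def findEdge : Cmd :=
  seq (setReg 13 (.const 0))
    (forPairs 7 8 (cond
      (.and (.and (nonzero (.arr 1 (.reg 7) (.reg 8))) leaves)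
        (.neg (.and (nonzero (.reg 13)) (.costLe (.reg 0) (.arr 1 (.reg 7) (.reg 8))))))
      (seq (setReg 13 (.const 1)) (seq (setReg 14 (.reg 7)) (seq (setReg 15 (.reg 8))
        (setCostReg 0 (.arr 1 (.reg 7) (.reg 8)))))) skip))

/-- Copy the cost array `a` to `b`. -/
def copyCosts (a b : ℕ) : Cmd :=
  forPairs 7 8 (setCostArr b (.reg 7) (.reg 8) (.arr a (.reg 7) (.reg 8)))

/-- Decrease the reduced costs of the pairs that leave the set found. -/
def reduceCosts : Cmd :=
  seq (forPairs 7 8 (cond leaves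
    (setCostArr 2 (.reg 7) (.reg 8) (.sub (.arr 1 (.reg 7) (.reg 8)) (.reg 0)))
    (setCostArr 2 (.reg 7) (.reg 8) (.arr 1 (.reg 7) (.reg 8)))))
    (copyCosts 2 1)

/-- One round of the primal-dual method. -/
def augment : Cmd :=
  seq scan (seq (setArr 9 (.reg 5) (.const 0) (.const 0)) (cond (nonzero (.reg 12))
    (seq findEdge (seq reduceCosts (seq (setArr 2 (.reg 14) (.reg 15) (.const 1))
      (seq (setArr 9 (.reg 5) (.const 0) (.const 1)) (seq
        (setArr 9 (.reg 5) (.const 1) (.reg 14)) (setArr 9 (.reg 5) (.const 2) (.reg 15))))))) skip))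

/-- One round of the reverse deletion. -/
def delete : Cmd :=
  seq (setReg 16 (.sub (.sub (.reg 1) (.const 1)) (.reg 5)))
    (cond (nonzero (.arr 9 (.reg 16) (.const 0)))
      (seq (setArr 2 (.arr 9 (.reg 16) (.const 1)) (.arr 9 (.reg 16) (.const 2)) (.const 0))
        (seq scan (cond (nonzero (.reg 12))
          (setArr 2 (.arr 9 (.reg 16) (.const 1)) (.arr 9 (.reg 16) (.const 2)) (.const 1))
          skip))) skip)

/-- Array `8`: the pairs `(a, v)` such that `a` lies in a core that avoids `v` and the node in
variable `3`. -/
def markForbidden : Cmd :=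
  forPairs 5 6 (seq (setArr 8 (.reg 5) (.reg 6) (.const 0))
    (cond (nonzero (.arr 6 (.reg 5) (.reg 6)))
      (seq (query false 5 (.reg 5) (.reg 6) 10 12 (.const 0))
        (cond (nonzero (.arr 12 (.const 0) (.reg 3))) skip
          (setArr 8 (.reg 5) (.reg 6) (.const 1)))) skip))

/-- Cover the halo of the core given by the variables `3` and `4`. -/
def coverHalo : Cmd :=
  seq (query false 5 (.reg 3) (.reg 4) 10 7 (.const 0)) (seq markForbidden
    (seq (copyCosts 0 1)
      (seq (forTo 5 1 augment) (forTo 5 1 delete))))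

/-- Array `6`: the pairs `(a, v)` such that `a` lies in a core that avoids `v`. -/
def markCores : Cmd :=
  forPairs 3 4 (seq (setArr 6 (.reg 3) (.reg 4) (.const 0))
    (seq (query false 5 (.reg 3) (.reg 4) 10 12 (.const 0)) (cond (nonzero (.reg 10))
      (seq (setArr 6 (.reg 3) (.reg 4) (.const 1))
        (forTo 7 0 (cond (nonzero (.arr 12 (.const 0) (.reg 7)))
          (seq (query false 5 (.reg 7) (.reg 4) 10 13 (.const 0))
            (cond (.and (nonzero (.reg 10)) (.neg (nonzero (.arr 13 (.const 0) (.reg 3)))))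
              (setArr 6 (.reg 3) (.reg 4) (.const 0)) skip)) skip))) skip)))

/-- Cover the halos of all cores. -/
def phase : Cmd :=
  seq (forPairs 3 4 (setArr 5 (.reg 3) (.reg 4) (.arr 2 (.reg 3) (.reg 4)))) (seq markCores
    (forPairs 3 4 (cond (nonzero (.arr 6 (.reg 3) (.reg 4))) coverHalo skip)))

/-- Put the square of variable `0` into variable `1`. -/
def square : Cmd := seq (setReg 1 (.const 0)) (forTo 2 0 (setReg 1 (.add (.reg 1) (.reg 0))))

/-- Variable `0` holds the number of nodes, and that many phases always suffice, as `n < 2 ^ n`. -/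
def main : Cmd := forTo 2 0 phase

end Cmd

/-! ### Queries -/

variable {n : ℕ} {S T : Finset (Fin n)} {F : Set (Finset (Fin n))}

/-- `z` is a characteristic vector of `X`. -/
def IsRow (z : ℕ → ℕ) (X : Finset (Fin n)) : Prop := ∀ i : Fin n, z i ≠ 0 ↔ i ∈ X

theorem isRow_indicator (X : Finset (Fin n)) : IsRow (indicator X) X := fun i => by
  simp [indicator]

theorem mem_edgesOf {m : ℕ → ℕ → ℕ} {e : Fin n × Fin n} :
    e ∈ edgesOf n m ↔ m e.1 e.2 ≠ 0 := by
  simp [edgesOf]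

theorem core_eq_none {G : Set (Finset (Fin n))} : core G = none ↔ G = ∅ := by
  unfold core
  split_ifs with h
  · obtain ⟨C, hC⟩ := h
    simpa using Set.nonempty_iff_ne_empty.1 ⟨C, hC.1⟩
  · simp only [true_iff]
    rw [Set.eq_empty_iff_forall_notMem]
    intro X hX
    obtain ⟨C, hC, -⟩ := exists_core_subset hX
    exact h ⟨C, hC⟩

theorem oracle_least (hF : IsSTCrossing S T F) (m : ℕ → ℕ → ℕ) (u v : Fin n) :
    (∃ C, IsLeast (residual S T F (edgesOf n m) u v) C ∧
      familyOracle S T F false m u v = some (indicator C)) ∨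
    (residual S T F (edgesOf n m) u v = ∅ ∧ familyOracle S T F false m u v = none) := by
  have h : familyOracle S T F false m u v =
      (core (residual S T F (edgesOf n m) u v)).map indicator := by
    simp [familyOracle]
  rw [h]
  rcases hc : core (residual S T F (edgesOf n m) u v) with _ | C
  · exact Or.inr ⟨core_eq_none.1 hc, rfl⟩
  · exact Or.inl ⟨C, (core_residual hF _ _ _ _).1 hc, rfl⟩

theorem oracle_greatest (hF : IsSTCrossing S T F) (m : ℕ → ℕ → ℕ) (u v : Fin n) :
    (∃ X, IsGreatest (residual S T F (edgesOf n m) u v) X ∧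
      familyOracle S T F true m u v = some (indicator Xᶜ)) ∨
    (residual S T F (edgesOf n m) u v = ∅ ∧ familyOracle S T F true m u v = none) := by
  have h : familyOracle S T F true m u v =
      (core (coFamily (residual S T F (edgesOf n m) u v))).map indicator := by
    simp [familyOracle]
  rw [h]
  rcases hc : core (coFamily (residual S T F (edgesOf n m) u v)) with _ | C
  · refine Or.inr ⟨?_, rfl⟩
    rw [core_eq_none, Set.eq_empty_iff_forall_notMem] at hc
    rw [Set.eq_empty_iff_forall_notMem]
    intro X hX
    exact hc Xᶜ (by simpa [coFamily] using hX)
  · exact Or.inl ⟨Cᶜ, (core_coFamily_residual hF _ _ _ _).1 hc, by simp⟩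

/-! ### Correctness of the parts of the program -/

open Cmd

theorem exec_buildQuery {O : Oracle} {s : State} (hn : s.reg 0 = n) (v : Fin n)
    (hv : s.reg 6 = v) :
    edgesOf n ((buildQuery.exec O s).arr 11) =
      edgesOf n (s.arr 2) ∪ {e ∈ edgesOf n (s.arr 8) | e.2 = v} := by
  have h1 := (exec_forTo_forall₂ (O := O) (x := 7) (y := 8) (s := s)
    (c := setArr 11 (.reg 7) (.reg 8) (.arr 2 (.reg 7) (.reg 8))) (fun _ => True)
    (fun i j s' => s'.arr 11 i j = s.arr 2 i j) hn (by decide) (by decide)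
    (fun _ _ => ⟨id, id⟩) (fun _ _ _ _ => ⟨id, id⟩) trivial (by
      intro i _ j _ s' h7 h8 hfr _
      have h2 := hfr.arr 2 (by decide)
      refine ⟨trivial, ?_, fun i' j' h hne => ?_⟩
      · simp [exec, NatExpr.eval, State.setArr_arr, h7, h8, h2]
      · simp only [exec, NatExpr.eval, State.setArr_arr, h7, h8]
        rw [if_neg (fun h => hne (by rw [h.2.1, h.2.2]))]
        exact h)).2
  set s₁ := (forPairs 7 8 (setArr 11 (.reg 7) (.reg 8) (.arr 2 (.reg 7) (.reg 8)))).exec O s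
    with hs₁
  have hfr₁ : Frame _ s s₁ := frame_exec O _ s
  have h2 := exec_forTo_induct (O := O) (x := 7) (r := 0) (s := s₁)
    (c := cond (nonzero (.arr 8 (.reg 7) (.reg 6)))
      (setArr 11 (.reg 7) (.reg 6) (.const 1)) skip)
    (fun k s' => ∀ i < n, ∀ j < n, s'.arr 11 i j ≠ 0 ↔
      (s.arr 2 i j ≠ 0 ∨ (i < k ∧ j = v ∧ s.arr 8 i j ≠ 0)))
    ((hfr₁.reg 0 (by decide)).trans hn) (fun i hi j hj => by simp [h1 i hi j hj]) (by
      intro k hk s' h7 hfr h i hi j hj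
      have h6 : s'.reg 6 = v := by
        rw [hfr.reg 6 (by decide), hfr₁.reg 6 (by decide), hv]
      have h8 : s'.arr 8 = s.arr 8 := by
        rw [hfr.arr 8 (by decide), hfr₁.arr 8 (by decide)]
      have hij := h i hi j hj
      have hlt : i < k + 1 ↔ i < k ∨ i = k := by omega
      by_cases hb : s.arr 8 k v = 0
      · have : ¬ (nonzero (.arr 8 (.reg 7) (.reg 6))).Holds s' := by
          simp [nonzero_holds, NatExpr.eval, h6, h7, h8, hb]
        rw [exec, if_neg this, exec, State.setReg_arr, hij, hlt]
        refine or_congr_right ⟨fun h => ⟨Or.inl h.1, h.2⟩, ?_⟩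
        rintro ⟨h | rfl, rfl, h'⟩
        · exact ⟨h, rfl, h'⟩
        · exact (h' hb).elim
      · have : (nonzero (.arr 8 (.reg 7) (.reg 6))).Holds s' := by
          simp [nonzero_holds, NatExpr.eval, h6, h7, h8, hb]
        rw [exec, if_pos this, exec, State.setReg_arr, hlt]
        simp only [NatExpr.eval, State.setArr_arr, h6, h7, true_and]
        split_ifs with hc
        · obtain ⟨rfl, rfl⟩ := hc
          simp [hb]
        · rw [hij]
          refine or_congr_right ⟨fun h => ⟨Or.inl h.1, h.2⟩, ?_⟩
          rintro ⟨h | rfl, rfl, h'⟩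
          · exact ⟨h, rfl, h'⟩
          · exact (hc ⟨rfl, rfl⟩).elim)
  ext e
  rw [mem_edgesOf, Finset.mem_union, Finset.mem_filter, mem_edgesOf, mem_edgesOf]
  rw [buildQuery, exec, ← hs₁]
  rw [h2 e.1 e.1.2 e.2 e.2.2]
  simp only [e.1.2, true_and, Fin.ext_iff]
  tauto

/-- The situation while the halo `G` of the core `C` is treated. -/
structure HaloContext (S T : Finset (Fin n)) (F G : Set (Finset (Fin n))) (C : Finset (Fin n))
    (J₀ B : Finset (Fin n × Fin n)) (σ : Fin n) : Prop where
  residual_eq : ∀ J, J₀ ⊆ J → ∀ v ∈ T, v ∉ C →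
    residual S T F (J ∪ {e ∈ B | e.2 = v}) σ v = {X | X ∈ uncovered G J ∧ v ∉ X}
  subset : ∀ X ∈ G, C ⊆ X
  exists_notMem : ∀ X ∈ G, ∃ t ∈ T, t ∉ X

/-- The memory while the halo of the core `C` is treated. -/
structure HaloMemory (C : Finset (Fin n)) (B : Finset (Fin n × Fin n)) (σ : Fin n)
    (s : State) : Prop where
  reg_zero : s.reg 0 = n
  reg_three : s.reg 3 = σ
  arr_seven : IsRow (s.arr 7 0) C
  arr_eight : edgesOf n (s.arr 8) = B

theorem HaloMemory.frame {C : Finset (Fin n)} {B : Finset (Fin n × Fin n)} {σ : Fin n}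
    {s s' : State} (h : HaloMemory C B σ s) (h0 : s'.reg 0 = s.reg 0) (h3 : s'.reg 3 = s.reg 3)
    (h7 : s'.arr 7 = s.arr 7) (h8 : s'.arr 8 = s.arr 8) : HaloMemory C B σ s' :=
  ⟨h0.trans h.1, h3.trans h.2, h7 ▸ h.3, h8 ▸ h.4⟩

/-- Row `0` of array `10` holds the complement of the current set, initially of the empty set. Only
nodes outside both `C` and the current set are queried. A newly found set is greatest among the
members missing `v`, and the old set misses `v`, so the sets increase. The final set therefore
dominates every member that misses a node of `T` in common with it. -/
theorem exec_scan {G : Set (Finset (Fin n))} {C : Finset (Fin n)}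
    {J₀ B : Finset (Fin n × Fin n)} {σ : Fin n} (hF : IsSTCrossing S T F)
    (hG : HaloContext S T F G C J₀ B σ) {s : State} (hs : HaloMemory C B σ s)
    (hJ : J₀ ⊆ edgesOf n (s.arr 2)) :
    ((scan.exec (familyOracle S T F) s).reg 12 = 0 ∧ uncovered G (edgesOf n (s.arr 2)) = ∅) ∨
    ((scan.exec (familyOracle S T F) s).reg 12 = 1 ∧
      ∃ X, IsTop T (uncovered G (edgesOf n (s.arr 2))) X ∧
        IsRow ((scan.exec (familyOracle S T F) s).arr 10 0) Xᶜ) := by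
  set O := familyOracle S T F with hO
  set J := edgesOf n (s.arr 2) with hJdef
  set s₁ := (setReg 12 (.const 0)).exec O s with hs₁
  set s₂ := (forTo 6 0 (setArr 10 (.const 0) (.reg 6) (.const 1))).exec O s₁ with hs₂
  have hfr₁ : Frame _ s s₁ := frame_exec O _ s
  have hfr₂ : Frame _ s₁ s₂ := frame_exec O _ s₁
  have h10 : ∀ i < n, s₂.arr 10 0 i = 1 := by
    refine exec_forTo_induct (O := O) (x := 6) (s := s₁)
      (c := setArr 10 (.const 0) (.reg 6) (.const 1))
      (fun k s' => ∀ i < k, s'.arr 10 0 i = 1) ((hfr₁.reg 0 (by decide)).trans hs.1) (by simp) ?_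
    intro k hk s' h6 _ h i hi
    simp only [exec, NatExpr.eval, State.setReg_arr, State.setArr_arr, h6, true_and]
    split_ifs with hik
    · rfl
    · exact h i (by omega)
  have hmain := exec_forTo_induct (O := O) (x := 6) (r := 0) (s := s₂)
    (c := cond (.and (nonzero (.arr 10 (.const 0) (.reg 6)))
          (.neg (nonzero (.arr 7 (.const 0) (.reg 6)))))
        (seq buildQuery (seq (query true 11 (.reg 3) (.reg 6) 10 10 (.const 0))
          (cond (nonzero (.reg 10)) (setReg 12 (.const 1)) skip))) skip)
    -- If nothing has been found, all uncovered members contain the processed nodes of `T` outside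
    -- `C`. Otherwise the current set contains every member avoiding a processed node of `T` that it
    -- avoids itself.
    (fun k s' =>
      (s'.reg 12 = 0 ∧ (∀ i < n, s'.arr 10 0 i = 1) ∧
        ∀ w : Fin n, w < k → w ∈ T → w ∉ C → ∀ X ∈ uncovered G J, w ∈ X) ∨
      (s'.reg 12 = 1 ∧ ∃ X ∈ uncovered G J, IsRow (s'.arr 10 0) Xᶜ ∧
        ∀ w : Fin n, w < k → w ∈ T → w ∉ X → ∀ W ∈ uncovered G J, w ∉ W → W ⊆ X))
    (by rw [hfr₂.reg 0 (by decide), hfr₁.reg 0 (by decide), hs.1])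
    (Or.inl ⟨by
      rw [State.setReg_reg, if_neg (by decide), hfr₂.reg 12 (by decide)]
      simp [hs₁, exec, NatExpr.eval], h10, by simp⟩) (by
      intro k hk s' h6 hfr hP
      have hn' : s'.reg 0 = n := by
        rw [hfr.reg 0 (by decide), hfr₂.reg 0 (by decide), hfr₁.reg 0 (by decide), hs.1]
      have h3 : s'.reg 3 = σ := by
        rw [hfr.reg 3 (by decide), hfr₂.reg 3 (by decide), hfr₁.reg 3 (by decide), hs.2]
      have h2 : s'.arr 2 = s.arr 2 := by
        rw [hfr.arr 2 (by decide), hfr₂.arr 2 (by decide), hfr₁.arr 2 (by decide)]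
      have h7 : s'.arr 7 = s.arr 7 := by
        rw [hfr.arr 7 (by decide), hfr₂.arr 7 (by decide), hfr₁.arr 7 (by decide)]
      have h8 : s'.arr 8 = s.arr 8 := by
        rw [hfr.arr 8 (by decide), hfr₂.arr 8 (by decide), hfr₁.arr 8 (by decide)]
      obtain ⟨v, rfl⟩ : ∃ v : Fin n, (v : ℕ) = k := ⟨⟨k, hk⟩, rfl⟩
      have hlt : ∀ w : Fin n, (w : ℕ) < v + 1 → w < v ∨ w = v := fun w hw => by
        rw [Fin.lt_def, Fin.ext_iff]
        omega
      have hvC : s'.arr 7 0 v ≠ 0 ↔ v ∈ C := by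
        rw [h7]
        exact hs.3 v
      by_cases htest : (Test.and (nonzero (.arr 10 (.const 0) (.reg 6)))
          (.neg (nonzero (.arr 7 (.const 0) (.reg 6))))).Holds s'
      · rw [exec, if_pos htest, exec, exec]
        simp only [Test.Holds, nonzero_holds, NatExpr.eval, h6, hvC] at htest
        obtain ⟨hv10, hvC'⟩ := htest
        have hb := exec_buildQuery (O := O) hn' v h6
        have hfrb := frame_exec O buildQuery s'
        set s₃ := buildQuery.exec O s' with hs₃
        rw [h2, h8, hs.4, ← hJdef] at hb
        have h3b : s₃.reg 3 = σ := by rw [hfrb.reg 3 (by decide), h3]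
        have h6b : s₃.reg 6 = v := by rw [hfrb.reg 6 (by decide), h6]
        have h10b : s₃.arr 10 = s'.arr 10 := hfrb.arr 10 (by decide)
        have h12b : s₃.reg 12 = s'.reg 12 := hfrb.reg 12 (by decide)
        rw [exec]
        simp only [NatExpr.eval, h3b, h6b]
        rcases oracle_greatest hF (s₃.arr 11) σ v with ⟨X, hX, hans⟩ | ⟨hemp, hans⟩
        · rw [hb] at hX
          have hvT : v ∈ T := (mem_residual.1 hX.1).2.2.2.1
          rw [hG.residual_eq J hJ v hvT hvC'] at hX
          obtain ⟨⟨hXG, hvX⟩, hXmax⟩ := hX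
          rw [hO, hans, exec, if_pos (by simp [nonzero_holds, NatExpr.eval, State.answer_reg])]
          refine Or.inr ⟨by simp [exec, NatExpr.eval], X, hXG, ?_, fun w hw hwT hwX W hW hwW => ?_⟩
          · simp only [exec, State.setReg_arr, State.answer_some_arr]
            exact isRow_indicator _
          · rcases hlt w hw with hw | rfl
            · rcases hP with ⟨-, -, hP⟩ | ⟨-, Y, hY, hYrow, hP⟩
              · exact (hwX (hP w hw hwT (fun h => hwX (hG.subset X hXG.1 h)) X hXG)).elim
              · have hvY : v ∉ Y := by simpa using (hYrow v).1 hv10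
                have hYX : Y ⊆ X := hXmax ⟨hY, hvY⟩
                exact (hP w hw hwT (fun h => hwX (hYX h)) W hW hwW).trans hYX
            · exact hXmax ⟨hW, hwW⟩
        · rw [hb] at hemp
          -- An empty answer means that no uncovered member of the halo avoids `v`, provided `v ∈
          -- T`; for other nodes the answer is always empty and nothing is needed.
          have hvX : v ∈ T → ∀ X ∈ uncovered G J, v ∈ X := fun hvT X hX => by
            by_contra hvX
            rw [hG.residual_eq J hJ v hvT hvC'] at hemp
            exact (Set.eq_empty_iff_forall_notMem.1 hemp X) ⟨hX, hvX⟩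
          rw [hO, hans, exec, if_neg (by simp [nonzero_holds, NatExpr.eval, State.answer_reg]),
            exec]
          simp only [State.setReg_reg, State.setReg_arr, State.answer_reg, State.answer_none_arr,
            h10b]
          refine hP.imp (fun ⟨h1, h2, h3⟩ => ⟨by simpa [h12b] using h1, h2, ?_⟩)
            fun ⟨h1, X, h2, h3, h4⟩ => ⟨by simpa [h12b] using h1, X, h2, h3, ?_⟩
          · intro w hw hwT hwC X hX
            rcases hlt w hw with hw | rfl
            · exact h3 w hw hwT hwC X hX
            · exact hvX hwT X hX
          · intro w hw hwT hwX W hW hwW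
            rcases hlt w hw with hw | rfl
            · exact h4 w hw hwT hwX W hW hwW
            · exact (hwX (hvX hwT X h2)).elim
      · rw [exec, if_neg htest, exec]
        simp only [Test.Holds, nonzero_holds, NatExpr.eval, h6, hvC] at htest
        simp only [State.setReg_reg, State.setReg_arr]
        refine hP.imp (fun ⟨h1, h2, h3⟩ => ⟨by simpa using h1, h2, ?_⟩)
            fun ⟨h1, X, h2, h3, h4⟩ => ⟨by simpa using h1, X, h2, h3, ?_⟩
        · intro w hw hwT hwC X hX
          rcases hlt w hw with hw | rfl
          · exact h3 w hw hwT hwC X hX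
          · exact (htest ⟨by simp [h2 w w.2], hwC⟩).elim
        · intro w hw hwT hwX W hW hwW
          rcases hlt w hw with hw | rfl
          · exact h4 w hw hwT hwX W hW hwW
          · exact (htest ⟨(h3 w).2 (by simpa using hwX), fun h => hwX (hG.subset X h2.1 h)⟩).elim)
  refine hmain.imp (fun ⟨h1, h2, h3⟩ => ⟨h1, ?_⟩) fun ⟨h1, X, h2, h3, h4⟩ =>
    ⟨h1, X, ⟨h2, fun W hW t ht htX htW => h4 t t.2 ht htX W hW htW⟩, h3⟩
  rw [Set.eq_empty_iff_forall_notMem]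
  intro X hX
  obtain ⟨t, ht, htX⟩ := hG.exists_notMem X hX.1
  exact htX (h3 t t.2 ht (fun h => htX (hG.subset X hX.1 h)) X hX)

end

/-! ### Rounds of augmentation and deletion -/

section

open Cmd
variable {n : ℕ} {S T : Finset (Fin n)} {F : Set (Finset (Fin n))}

theorem leaves_holds {s : State} {X : Finset (Fin n)} (hX : IsRow (s.arr 10 0) Xᶜ)
    {e : Fin n × Fin n} (h7 : s.reg 7 = e.1) (h8 : s.reg 8 = e.2) :
    leaves.Holds s ↔ Covers e X := by
  have h1 := hX e.1
  have h2 := hX e.2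
  simp only [Finset.mem_compl] at h1 h2
  simp only [leaves, Test.Holds, nonzero_holds, NatExpr.eval, h7, h8, h1, h2, Covers, not_not]

theorem exec_findEdge {O : Oracle} {s : State} (hn : s.reg 0 = n) {X : Finset (Fin n)}
    (hX : IsRow (s.arr 10 0) Xᶜ) (hE : ∃ e ∈ edgesOf n (s.arr 1), Covers e X) :
    ∃ e ∈ edgesOf n (s.arr 1), Covers e X ∧
      (∀ f ∈ edgesOf n (s.arr 1), Covers f X → s.costArr 1 e.1 e.2 ≤ s.costArr 1 f.1 f.2) ∧
      (findEdge.exec O s).reg 14 = e.1 ∧ (findEdge.exec O s).reg 15 = e.2 ∧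
      (findEdge.exec O s).costReg 0 = s.costArr 1 e.1 e.2 := by
  obtain ⟨e₀, he₀, he₀X⟩ := hE
  rw [findEdge, exec]
  set s₁ := (setReg 13 (.const 0)).exec O s with hs₁
  have hfr₁ : Frame _ s s₁ := frame_exec O _ s
  have h := exec_forTo_forall₂ (O := O) (x := 7) (y := 8) (s := s₁)
    (c := cond (.and (.and (nonzero (.arr 1 (.reg 7) (.reg 8))) leaves)
        (.neg (.and (nonzero (.reg 13)) (.costLe (.reg 0) (.arr 1 (.reg 7) (.reg 8))))))
      (seq (setReg 13 (.const 1)) (seq (setReg 14 (.reg 7)) (seq (setReg 15 (.reg 8))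
        (setCostReg 0 (.arr 1 (.reg 7) (.reg 8)))))) skip)
    (fun s' => s'.reg 13 ≠ 0 → ∃ e ∈ edgesOf n (s.arr 1), Covers e X ∧
      s'.reg 14 = e.1 ∧ s'.reg 15 = e.2 ∧ s'.costReg 0 = s.costArr 1 e.1 e.2)
    (fun i j s' => ∀ f ∈ edgesOf n (s.arr 1), Covers f X → f.1 = i → f.2 = j →
      s'.reg 13 ≠ 0 ∧ s'.costReg 0 ≤ s.costArr 1 f.1 f.2)
    ((hfr₁.reg 0 (by decide)).trans hn) (by decide) (by decide)
    (fun _ _ => ⟨by simp, by simp⟩) (fun _ _ _ _ => ⟨by simp, by simp⟩)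
    (by simp [hs₁, exec, NatExpr.eval]) (by
      intro i hi j hj s' h7 h8 hfr hI
      obtain ⟨e, rfl, rfl⟩ : ∃ e : Fin n × Fin n, (e.1 : ℕ) = i ∧ (e.2 : ℕ) = j :=
        ⟨(⟨i, hi⟩, ⟨j, hj⟩), rfl, rfl⟩
      have h1 : s'.arr 1 = s.arr 1 := by rw [hfr.arr 1 (by decide), hfr₁.arr 1 (by decide)]
      have h10 : s'.arr 10 = s.arr 10 := by rw [hfr.arr 10 (by decide), hfr₁.arr 10 (by decide)]
      have hc : s'.costArr 1 = s.costArr 1 := by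
        rw [hfr.costArr 1 (by decide), hfr₁.costArr 1 (by decide)]
      have hl := leaves_holds (h10 ▸ hX : IsRow (s'.arr 10 0) Xᶜ) h7 h8
      have heq : ∀ f : Fin n × Fin n, (f.1 : ℕ) = e.1 → (f.2 : ℕ) = e.2 → f = e :=
        fun f h h' => Prod.ext (Fin.ext h) (Fin.ext h')
      rw [exec]
      split_ifs with htest
      · simp only [Test.Holds, hl, nonzero_holds, NatExpr.eval, CostExpr.eval, h7, h8, h1,
          hc] at htest
        obtain ⟨⟨he, heX⟩, hlt⟩ := htest
        simp only [exec, NatExpr.eval, CostExpr.eval, State.setReg_reg, State.setCostReg_reg,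
          State.setCostReg_costReg, State.setReg_costArr, h7, h8, hc]
        norm_num
        refine ⟨⟨e.1, e.2, mem_edgesOf.2 he, heX, rfl, rfl, rfl⟩, ?_, ?_⟩
        · rintro a b - - ha hb
          rw [ha, hb]
        · intro i' j' hQ _ a b hf hfX ha hb
          obtain ⟨h3, h4⟩ := hQ a b hf hfX ha hb
          -- The record is overwritten only by a strictly smaller cost, so bounds obtained earlier
          -- persist.
          by_contra hcon
          exact hlt ⟨h3, by linarith⟩
      · rw [exec]
        refine ⟨hI, ?_, fun i' j' h _ => h⟩
        intro f hf hfX h3 h4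
        obtain rfl := heq f h3 h4
        simp only [Test.Holds, hl, nonzero_holds, NatExpr.eval, CostExpr.eval, h7, h8, h1,
          hc] at htest
        by_contra hcon
        exact htest ⟨⟨mem_edgesOf.1 hf, hfX⟩, hcon⟩)
  obtain ⟨hI, hQ⟩ := h
  obtain ⟨e, he, heX, h1, h2, h3⟩ := hI (hQ e₀.1 e₀.1.2 e₀.2 e₀.2.2 e₀ he₀ he₀X rfl rfl).1
  exact ⟨e, he, heX, fun f hf hfX => h3 ▸ (hQ f.1 f.1.2 f.2 f.2.2 f hf hfX rfl rfl).2, h1, h2, h3⟩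

theorem exec_copyCosts {O : Oracle} {s : State} (hn : s.reg 0 = n) {a b : ℕ} (hab : a ≠ b)
    (e : Fin n × Fin n) :
    ((copyCosts a b).exec O s).costArr b e.1 e.2 = s.costArr a e.1 e.2 := by
  refine (exec_forTo_forall₂ (O := O) (x := 7) (y := 8) (s := s)
    (c := setCostArr b (.reg 7) (.reg 8) (.arr a (.reg 7) (.reg 8))) (fun _ => True)
    (fun i j s' => s'.costArr b i j = s.costArr a i j) hn (by simp [regs]) (by simp [regs])
    (fun _ _ => ⟨id, id⟩) (fun _ _ _ _ => ⟨id, id⟩) trivial ?_).2 e.1 e.1.2 e.2 e.2.2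
  intro i _ j _ s' h7 h8 hfr _
  have h2 := hfr.costArr a (by simpa [costArrs] using hab)
  refine ⟨trivial, ?_, fun i' j' h hne => ?_⟩
  · simp [exec, NatExpr.eval, CostExpr.eval, State.setCostArr_costArr, h7, h8, h2]
  · simp only [exec, NatExpr.eval, State.setCostArr_costArr, h7, h8]
    rw [if_neg (fun h => hne (by rw [h.2.1, h.2.2]))]
    exact h

open Classical in
-- The new costs go through cost array `2`, so that during the loop cost array `1` is unchanged and
-- each entry is computed independently of the others.
theorem exec_reduceCosts {O : Oracle} {s : State} (hn : s.reg 0 = n) {X : Finset (Fin n)}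
    (hX : IsRow (s.arr 10 0) Xᶜ) (e : Fin n × Fin n) :
    (reduceCosts.exec O s).costArr 1 e.1 e.2 =
      if Covers e X then s.costArr 1 e.1 e.2 - s.costReg 0 else s.costArr 1 e.1 e.2 := by
  rw [reduceCosts, exec]
  set s₁ := (forPairs 7 8 _).exec O s with hs₁
  have hfr₁ : Frame _ s s₁ := frame_exec O _ s
  rw [exec_copyCosts ((hfr₁.reg 0 (by decide)).trans hn) (by decide)]
  refine (exec_forTo_forall₂ (O := O) (x := 7) (y := 8) (s := s)
    (c := cond leaves
      (setCostArr 2 (.reg 7) (.reg 8) (.sub (.arr 1 (.reg 7) (.reg 8)) (.reg 0)))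
      (setCostArr 2 (.reg 7) (.reg 8) (.arr 1 (.reg 7) (.reg 8)))) (fun _ => True)
    (fun i j s' => ∀ e : Fin n × Fin n, e.1 = i → e.2 = j → s'.costArr 2 i j =
      if Covers e X then s.costArr 1 e.1 e.2 - s.costReg 0 else s.costArr 1 e.1 e.2) hn
    (by decide) (by decide) (fun _ _ => ⟨id, id⟩) (fun _ _ _ _ => ⟨id, id⟩) trivial
    ?_).2 e.1 e.1.2 e.2 e.2.2 e rfl rfl
  intro i _ j _ s' h7 h8 hfr _
  have h10 : s'.arr 10 = s.arr 10 := hfr.arr 10 (by decide)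
  have h1 := hfr.costArr 1 (by decide)
  have h0 := hfr.costReg 0 (by decide)
  refine ⟨trivial, ?_, fun i' j' h hne e hi hj => ?_⟩
  · rintro e rfl rfl
    have hl := leaves_holds (h10 ▸ hX : IsRow (s'.arr 10 0) Xᶜ) h7 h8
    simp only [exec, hl]
    split_ifs <;>
      simp [NatExpr.eval, CostExpr.eval, State.setCostArr_costArr, h7, h8, h1, h0]
  · rw [← h e hi hj, exec]
    have hne' : ¬ (i' = i ∧ j' = j) := fun h => hne (by rw [h.1, h.2])
    split_ifs <;>
      simp [exec, NatExpr.eval, State.setCostArr_costArr, h7, h8, hne']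

theorem edgesOf_setArr_insert (s : State) {a z : ℕ} (hz : z ≠ 0) (e : Fin n × Fin n) :
    edgesOf n ((s.setArr a e.1 e.2 z).arr a) = insert e (edgesOf n (s.arr a)) := by
  ext f
  rw [Finset.mem_insert, mem_edgesOf, mem_edgesOf, State.setArr_arr, Prod.ext_iff, Fin.ext_iff,
    Fin.ext_iff]
  split_ifs with h <;> tauto

theorem edgesOf_setArr_erase (s : State) (a : ℕ) (e : Fin n × Fin n) :
    edgesOf n ((s.setArr a e.1 e.2 0).arr a) = (edgesOf n (s.arr a)).erase e := by
  ext f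
  rw [Finset.mem_erase, mem_edgesOf, mem_edgesOf, State.setArr_arr, ne_eq f, Prod.ext_iff, Fin.ext_iff,
    Fin.ext_iff]
  split_ifs with h <;> tauto

/-- The row `z` records the edge that was added, if any. -/
def IsEntry (z : ℕ → ℕ) : Option (Fin n × Fin n) → Prop
  | none => z 0 = 0
  | some e => z 0 ≠ 0 ∧ z 1 = e.1 ∧ z 2 = e.2

section

variable {G : Set (Finset (Fin n))} {C : Finset (Fin n)} {J₀ B : Finset (Fin n × Fin n)} {σ : Fin n}
  {s : State}

/-- The reduced costs. -/
def costsOf (n : ℕ) (m : ℕ → ℕ → ℝ) (e : Fin n × Fin n) : ℝ := m e.1 e.2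

theorem exec_augment (hF : IsSTCrossing S T F)
    (hG : HaloContext S T F G C J₀ B σ) (hs : HaloMemory C B σ s)
    (hJ : J₀ ⊆ edgesOf n (s.arr 2)) (hE : IsEdgeCover (edgesOf n (s.arr 1)) G) {k : ℕ}
    (hk : s.reg 5 = k) :
    ∃ o, IsAugmentation T (edgesOf n (s.arr 1)) G (edgesOf n (s.arr 2))
        (edgesOf n ((augment.exec (familyOracle S T F) s).arr 2)) (costsOf n (s.costArr 1))
        (costsOf n ((augment.exec (familyOracle S T F) s).costArr 1)) o ∧
      IsEntry ((augment.exec (familyOracle S T F) s).arr 9 k) o ∧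
      ∀ i, i ≠ k → ∀ j, (augment.exec (familyOracle S T F) s).arr 9 i j = s.arr 9 i j := by
  have hscan := exec_scan hF hG hs hJ
  set O := familyOracle S T F
  rw [augment, exec, exec]
  have hfr₁ := frame_exec O scan s
  set s₁ := scan.exec O s with hs₁
  have h5 : s₁.reg 5 = k := by rw [hfr₁.reg 5 (by decide), hk]
  set s₂ := (setArr 9 (.reg 5) (.const 0) (.const 0)).exec O s₁ with hs₂
  have hs₂' : s₂ = s₁.setArr 9 k 0 0 := by rw [hs₂, exec]; simp only [NatExpr.eval, h5]
  have hfr₂ : Frame _ s₁ s₂ := frame_exec O _ s₁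
  have h9₂ : ∀ i, i ≠ k → ∀ j, s₂.arr 9 i j = s.arr 9 i j := fun i hi j => by
    rw [hs₂', State.setArr_arr, if_neg (fun h => hi h.2.1), hfr₁.arr 9 (by decide)]
  have h12 : s₂.reg 12 = s₁.reg 12 := hfr₂.reg 12 (by decide)
  rcases hscan with ⟨hfound, hemp⟩ | ⟨hfound, X, hX, hXrow⟩
  · rw [exec, if_neg (by simp [nonzero_holds, NatExpr.eval, h12, hfound]), exec]
    refine ⟨none, Or.inl ⟨hemp, ?_, ?_, rfl⟩, ?_, h9₂⟩
    · rw [hfr₂.arr 2 (by decide), hfr₁.arr 2 (by decide)]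
    · rw [hfr₂.costArr 1 (by decide), hfr₁.costArr 1 (by decide)]
    · simp [IsEntry, hs₂', State.setArr_arr]
  · rw [exec, if_pos (by simp [nonzero_holds, NatExpr.eval, h12, hfound]), exec, exec]
    have hn₂ : s₂.reg 0 = n := by rw [hfr₂.reg 0 (by decide), hfr₁.reg 0 (by decide), hs.1]
    have hX₂ : IsRow (s₂.arr 10 0) Xᶜ := by rwa [hfr₂.arr 10 (by decide)]
    have h1₂ : s₂.arr 1 = s.arr 1 := by rw [hfr₂.arr 1 (by decide), hfr₁.arr 1 (by decide)]
    have hc₂ : s₂.costArr 1 = s.costArr 1 := by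
      rw [hfr₂.costArr 1 (by decide), hfr₁.costArr 1 (by decide)]
    obtain ⟨e, he, heX, hmin, h14, h15, hcr⟩ := exec_findEdge (O := O) hn₂ hX₂
      (h1₂ ▸ hE X hX.1.1)
    rw [h1₂] at he hmin
    rw [hc₂] at hmin hcr
    have hfr₃ := frame_exec O findEdge s₂
    set s₃ := findEdge.exec O s₂ with hs₃
    have hX₃ : IsRow (s₃.arr 10 0) Xᶜ := by rwa [hfr₃.arr 10 (by decide)]
    have hred := exec_reduceCosts (O := O) ((hfr₃.reg 0 (by decide)).trans hn₂) hX₃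
    rw [hfr₃.costArr 1 (by decide), hc₂, hcr] at hred
    have hfr₄ := frame_exec O reduceCosts s₃
    set s₄ := reduceCosts.exec O s₃ with hs₄
    have h14₄ : s₄.reg 14 = e.1 := (hfr₄.reg 14 (by decide)).trans h14
    have h15₄ : s₄.reg 15 = e.2 := (hfr₄.reg 15 (by decide)).trans h15
    have h5₄ : s₄.reg 5 = k := by
      rw [hfr₄.reg 5 (by decide), hfr₃.reg 5 (by decide), hfr₂.reg 5 (by decide), h5]
    have h2₄ : s₄.arr 2 = s.arr 2 := by
      rw [hfr₄.arr 2 (by decide), hfr₃.arr 2 (by decide), hfr₂.arr 2 (by decide),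
        hfr₁.arr 2 (by decide)]
    have h9₄ : s₄.arr 9 = s₂.arr 9 := by rw [hfr₄.arr 9 (by decide), hfr₃.arr 9 (by decide)]
    simp only [exec, NatExpr.eval, State.setArr_reg, State.setArr_costArr, h14₄, h15₄, h5₄]
    refine ⟨some e, Or.inr ⟨X, hX, e, he, heX, hmin, ?_, fun f hf => ?_, fun f hf => ?_, rfl⟩,
      ?_, fun i hi j => ?_⟩
    · rw [State.setArr_arr_of_ne _ _ _ _ _ (by decide), State.setArr_arr_of_ne _ _ _ _ _ (by decide),
        State.setArr_arr_of_ne _ _ _ _ _ (by decide), edgesOf_setArr_insert _ one_ne_zero, h2₄]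
    · rw [costsOf, hred, if_pos hf]
      rfl
    · rw [costsOf, hred, if_neg hf]
      rfl
    · simp [IsEntry, State.setArr_arr]
    · simp only [State.setArr_arr, hi, false_and, and_false, if_false]
      rw [if_neg (by simp), h9₄, h9₂ i hi j]

/-- The edge is removed tentatively and restored if the scan finds an uncovered member. The
hypothesis that `J₀` survives the removal is needed because the artificial edges describe the halo
only for sets containing `J₀`. -/
theorem exec_delete (hF : IsSTCrossing S T F)
    (hG : HaloContext S T F G C J₀ B σ) (hs : HaloMemory C B σ s) {k N : ℕ}
    (hk : s.reg 5 = k) (hN : s.reg 1 = N) {o : Option (Fin n × Fin n)}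
    (ho : IsEntry (s.arr 9 (N - 1 - k)) o)
    (hJ : ∀ e, o = some e → e ∈ edgesOf n (s.arr 2) ∧ J₀ ⊆ (edgesOf n (s.arr 2)).erase e) :
    IsDeletion G (edgesOf n (s.arr 2))
      (edgesOf n ((delete.exec (familyOracle S T F) s).arr 2)) o := by
  set O := familyOracle S T F with hO
  rw [delete, exec]
  set s₁ := (setReg 16 (.sub (.sub (.reg 1) (.const 1)) (.reg 5))).exec O s with hs₁
  have hfr₁ : Frame _ s s₁ := frame_exec O _ s
  have h16 : s₁.reg 16 = N - 1 - k := by simp [hs₁, exec, NatExpr.eval, hk, hN]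
  have h9 : s₁.arr 9 = s.arr 9 := hfr₁.arr 9 (by decide)
  have h2 : s₁.arr 2 = s.arr 2 := hfr₁.arr 2 (by decide)
  rcases o with _ | e
  · rw [exec, if_neg, exec]
    · exact Or.inl ⟨rfl, by rw [h2]⟩
    · simpa [nonzero_holds, NatExpr.eval, h16, h9, IsEntry] using ho
  · obtain ⟨ho0, ho1, ho2⟩ := ho
    obtain ⟨heD, hJe⟩ := hJ e rfl
    rw [exec_cond_pos (by simpa [nonzero_holds, NatExpr.eval, h16, h9] using ho0), exec_seq,
      exec_seq]
    set s₂ := (setArr 2 (.arr 9 (.reg 16) (.const 1)) (.arr 9 (.reg 16) (.const 2))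
      (.const 0)).exec O s₁ with hs₂
    have hs₂' : s₂ = s₁.setArr 2 e.1 e.2 0 := by
      rw [hs₂, exec]
      simp only [NatExpr.eval, h16, h9, ho1, ho2]
    have hfr₂ : Frame _ s₁ s₂ := frame_exec O _ s₁
    have hD₂ : edgesOf n (s₂.arr 2) = (edgesOf n (s.arr 2)).erase e := by
      rw [hs₂', edgesOf_setArr_erase, h2]
    have hmem : HaloMemory C B σ s₂ := hs.frame
      (by rw [hfr₂.reg 0 (by decide), hfr₁.reg 0 (by decide)])
      (by rw [hfr₂.reg 3 (by decide), hfr₁.reg 3 (by decide)])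
      (by rw [hfr₂.arr 7 (by decide), hfr₁.arr 7 (by decide)])
      (by rw [hfr₂.arr 8 (by decide), hfr₁.arr 8 (by decide)])
    have hscan := exec_scan hF hG hmem (hD₂ ▸ hJe)
    rw [← hO, hD₂] at hscan
    have hfr₃ := frame_exec O scan s₂
    set s₃ := scan.exec O s₂ with hs₃
    have h2₃ : s₃.arr 2 = s₂.arr 2 := hfr₃.arr 2 (by decide)
    refine Or.inr ⟨e, rfl, ?_⟩
    rcases hscan with ⟨hfound, hemp⟩ | ⟨hfound, X, hX, -⟩
    · rw [exec, if_neg (by simp [nonzero_holds, NatExpr.eval, hfound]), exec, h2₃, hD₂]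
      exact Or.inl ⟨hemp, rfl⟩
    · rw [exec, if_pos (by simp [nonzero_holds, NatExpr.eval, hfound]), exec]
      have h16₃ : s₃.reg 16 = N - 1 - k := by
        rw [hfr₃.reg 16 (by decide), hfr₂.reg 16 (by decide), h16]
      have h9₃ : s₃.arr 9 = s.arr 9 := by
        rw [hfr₃.arr 9 (by decide), hfr₂.arr 9 (by decide), h9]
      simp only [NatExpr.eval, h16₃, h9₃, ho1, ho2]
      rw [edgesOf_setArr_insert _ one_ne_zero, h2₃, hD₂, Finset.insert_erase heD]
      exact Or.inr ⟨⟨X, hX.1⟩, rfl⟩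

end

end

/-! ### Covering a halo, marking cores, phases and the whole run -/

section

open Cmd
variable {n : ℕ} {S T : Finset (Fin n)} {F : Set (Finset (Fin n))}

section

variable {G : Set (Finset (Fin n))} {C : Finset (Fin n)} {J₀ B : Finset (Fin n × Fin n)} {σ : Fin n}
  {s : State}

open Classical in
theorem exec_primal_dual (hF : IsSTCrossing S T F)
    (hG : HaloContext S T F G C J₀ B σ)
    (hGi : ∀ X ∈ G, ∀ Y ∈ G, ∀ t ∈ T, t ∉ X → t ∉ Y → X ∩ Y ∈ G)
    (hs : HaloMemory C B σ s) (hN : s.reg 1 = n * n)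
    (hJ : J₀ ⊆ edgesOf n (s.arr 2)) (hE : IsEdgeCover (edgesOf n (s.arr 1)) G)
    (hET : ∀ e ∈ edgesOf n (s.arr 1), e.2 ∈ T)
    (hc : ∀ e ∈ edgesOf n (s.arr 1), 0 ≤ costsOf n (s.costArr 1) e)
    {J' : Finset (Fin n × Fin n)}
    (hJ' : J' = edgesOf n (((seq (forTo 5 1 augment) (forTo 5 1 delete)).exec
      (familyOracle S T F) s).arr 2)) :
    edgesOf n (s.arr 2) ⊆ J' ∧ J' \ edgesOf n (s.arr 2) ⊆ edgesOf n (s.arr 1) ∧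
      IsEdgeCover J' G ∧ ∀ x, IsFractionalCover (edgesOf n (s.arr 1)) G x →
        ∑ e ∈ J' \ edgesOf n (s.arr 2), costsOf n (s.costArr 1) e ≤
          ∑ e ∈ edgesOf n (s.arr 1) with ∃ X ∈ uncovered G (edgesOf n (s.arr 2)), Covers e X,
            costsOf n (s.costArr 1) e * x e := by
  set O := familyOracle S T F with hO
  set E := edgesOf n (s.arr 1) with hEdef
  set a : ℕ → State := loopState (augment.exec O) 5 s with ha
  have hfa : ∀ k, Frame (forTo 5 1 augment) s (a k) :=
    fun k => frame_loopState (frame_exec O augment) 5 1 s k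
  have hma : ∀ k, HaloMemory C B σ (a k) := fun k => hs.frame ((hfa k).reg 0 (by decide))
    ((hfa k).reg 3 (by decide)) ((hfa k).arr 7 (by decide)) ((hfa k).arr 8 (by decide))
  have h1a : ∀ k, edgesOf n ((a k).arr 1) = E := fun k => by rw [(hfa k).arr 1 (by decide)]
  have hstep : ∀ k, J₀ ⊆ edgesOf n ((a k).arr 2) →
      ∃ o, IsAugmentation T E G (edgesOf n ((a k).arr 2)) (edgesOf n ((a (k + 1)).arr 2))
        (costsOf n ((a k).costArr 1)) (costsOf n ((a (k + 1)).costArr 1)) o ∧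
        IsEntry ((a (k + 1)).arr 9 k) o ∧
        ∀ i, i ≠ k → ∀ j, (a (k + 1)).arr 9 i j = (a k).arr 9 i j := fun k hk => by
    have := exec_augment hF hG (hma k) hk (h1a k ▸ hE) (k := k) (loopState_reg s k)
    rwa [h1a k] at this
  have hJa : ∀ k, J₀ ⊆ edgesOf n ((a k).arr 2) := by
    intro k
    induction k with
    | zero => exact hJ
    | succ k ih =>
      obtain ⟨o, ho, -⟩ := hstep k ih
      exact ih.trans ho.subset
  choose o haug hentry hother using fun k => hstep k (hJa k)
  have hrow : ∀ i k, i < k → IsEntry ((a k).arr 9 i) (o i) := by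
    intro i k hik
    induction k, hik using Nat.le_induction with
    | base => exact hentry i
    | succ k hk ih =>
      have : (a (k + 1)).arr 9 i = (a k).arr 9 i :=
        funext fun j => hother k i (Nat.ne_of_lt hk) j
      rwa [this]
  set s₁ := a (n * n) with hs₁
  set d : ℕ → State := loopState (delete.exec O) 5 s₁ with hd
  have hfd : ∀ k, Frame (forTo 5 1 delete) s₁ (d k) :=
    fun k => frame_loopState (frame_exec O delete) 5 1 s₁ k
  have hmd : ∀ k, HaloMemory C B σ (d k) := fun k =>
    (hma (n * n)).frame ((hfd k).reg 0 (by decide))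
    ((hfd k).reg 3 (by decide)) ((hfd k).arr 7 (by decide)) ((hfd k).arr 8 (by decide))
  have hN₁ : s₁.reg 1 = n * n := by rw [(hfa _).reg 1 (by decide), hN]
  have hfin : J' = edgesOf n ((d (n * n)).arr 2) := by
    rw [hJ', exec_seq, exec, exec, hN, ← ha, ← hs₁, hN₁]
  have hcov := augmentation_covers (N := n * n) (fun k _ => haug k) hE le_rfl
  -- Each deletion round presupposes that its edge is still present and that `J₀` would survive.
  -- Both follow from `deletion_invariant` for the earlier rounds, so the rounds are verified by
  -- induction.
  have hdel : ∀ k ≤ n * n, ∀ j < k, IsDeletion G (edgesOf n ((d j).arr 2))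
      (edgesOf n ((d (j + 1)).arr 2)) (o (n * n - 1 - j)) := by
    intro k
    induction k with
    | zero => simp
    | succ k ih =>
      intro hk j hj
      rcases (Nat.lt_succ_iff.1 hj).lt_or_eq with hj | rfl
      · exact ih (by omega) j hj
      · refine exec_delete hF hG (hmd j) (loopState_reg s₁ j)
          (((hfd j).reg 1 (by decide)).trans hN₁) ?_ fun e he => ?_
        · rw [(hfd j).arr 9 (by decide)]
          exact hrow _ _ (by omega)
        · have hinv := (deletion_invariant (D := fun j => edgesOf n ((d j).arr 2))
            (fun k _ => haug k) hcov rfl (show j ≤ n * n by omega) (ih (by omega))).1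
          have hidx : n * n - 1 - j + 1 = n * n - j := by omega
          have h1 := haug (n * n - 1 - j)
          rw [he, hidx] at h1
          obtain ⟨-, h2, h3⟩ := h1.notMem
          exact ⟨hinv h3, fun f hf => Finset.mem_erase.2
            ⟨fun h => h2 (h ▸ hJa _ hf), hinv (h1.subset (hJa _ hf))⟩⟩
  have := primal_dual (N := n * n) (D := fun j => edgesOf n ((d j).arr 2)) hGi hET hE le_rfl hc
    rfl (fun k _ => haug k) rfl (hdel _ le_rfl)
  rw [hfin]
  exact this

end

/-- The pairs `(a, v)` such that `a ∈ S` lies in a core that avoids `v ∈ T`, as recorded in the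
array `m`. -/
def MarksCores (S T : Finset (Fin n)) (F : Set (Finset (Fin n))) (m : ℕ → ℕ → ℕ) : Prop :=
  ∀ a v : Fin n, m a v ≠ 0 ↔ ∃ D, IsCore F D ∧ a ∈ S ∧ a ∈ D ∧ v ∈ T ∧ v ∉ D

/-- For a marked pair the least member of `F^J(a,v)` is the unique core containing `a` and avoiding
`v`, so one query and one look at the node in variable `3` decide the entry. -/
theorem exec_markForbidden (hF : IsSTCrossing S T F) {s : State} (hn : s.reg 0 = n)
    {J₀ : Finset (Fin n × Fin n)} (h5 : edgesOf n (s.arr 5) = J₀)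
    (h6 : MarksCores S T (uncovered F J₀) (s.arr 6)) {σ : Fin n} (h3 : s.reg 3 = σ)
    (e : Fin n × Fin n) :
    e ∈ edgesOf n ((markForbidden.exec (familyOracle S T F) s).arr 8) ↔
      ∃ D, IsCore (uncovered F J₀) D ∧ e.1 ∈ S ∧ e.1 ∈ D ∧ e.2 ∈ T ∧ e.2 ∉ D ∧ σ ∉ D := by
  set O := familyOracle S T F with hO
  rw [mem_edgesOf]
  refine (exec_forTo_forall₂ (O := O) (x := 5) (y := 6) (s := s) (fun _ => True)
    (fun i j s' => ∀ e : Fin n × Fin n, e.1 = i → e.2 = j → (s'.arr 8 i j ≠ 0 ↔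
      ∃ D, IsCore (uncovered F J₀) D ∧ e.1 ∈ S ∧ e.1 ∈ D ∧ e.2 ∈ T ∧ e.2 ∉ D ∧ σ ∉ D)) hn
    (by decide) (by decide) (fun _ _ => ⟨id, id⟩) (fun _ _ _ _ => ⟨id, id⟩) trivial
    ?_).2 e.1 e.1.2 e.2 e.2.2 e rfl rfl
  intro i hi j hj s' h5' h6' hfr _
  refine ⟨trivial, ?_, fun i' j' h hne e hi hj => ?_⟩
  · rintro e rfl rfl
    rw [exec_seq]
    set s₁ := (setArr 8 (.reg 5) (.reg 6) (.const 0)).exec O s' with hs₁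
    have hs₁' : s₁ = s'.setArr 8 e.1 e.2 0 := by simp [hs₁, exec, NatExpr.eval, h5', h6']
    have hfr₁ : Frame _ s' s₁ := frame_exec O _ s'
    have h5₁ : s₁.reg 5 = e.1 := by rw [hfr₁.reg 5 (by decide), h5']
    have h6₁ : s₁.reg 6 = e.2 := by rw [hfr₁.reg 6 (by decide), h6']
    have h3₁ : s₁.reg 3 = σ := by rw [hfr₁.reg 3 (by decide), hfr.reg 3 (by decide), h3]
    have ha5 : edgesOf n (s₁.arr 5) = J₀ := by
      rw [hfr₁.arr 5 (by decide), hfr.arr 5 (by decide), h5]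
    have ha6 : s₁.arr 6 = s.arr 6 := by rw [hfr₁.arr 6 (by decide), hfr.arr 6 (by decide)]
    have h8₁ : s₁.arr 8 e.1 e.2 = 0 := by simp [hs₁', State.setArr_arr]
    by_cases hm : s.arr 6 e.1 e.2 = 0
    · rw [exec_cond_neg (by simp [nonzero_holds, NatExpr.eval, h5₁, h6₁, ha6, hm]), exec]
      refine iff_of_false (by simp [h8₁]) ?_
      rintro ⟨D, h1, h2, h3, h4, h5, -⟩
      exact (h6 e.1 e.2).2 ⟨D, h1, h2, h3, h4, h5⟩ hm
    · obtain ⟨D, hD, haS, haD, hvT, hvD⟩ := (h6 e.1 e.2).1 hm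
      have hleast := isLeast_residual_of_isCore hF hD haS haD hvT hvD
      rw [exec_cond_pos (by simpa [nonzero_holds, NatExpr.eval, h5₁, h6₁, ha6] using hm), exec_seq]
      have hans : O false (s₁.arr 5) e.1 e.2 = some (indicator D) := by
        rcases oracle_least hF (s₁.arr 5) e.1 e.2 with ⟨D', hD', h⟩ | ⟨h, -⟩
        · rw [ha5] at hD'
          rw [hO, h, hD'.unique hleast]
        · rw [ha5] at h
          exact (Set.eq_empty_iff_forall_notMem.1 h D hleast.1).elim
      have hs₂ : (query false 5 (.reg 5) (.reg 6) 10 12 (.const 0)).exec O s₁ =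
          s₁.answer 10 12 0 (some (indicator D)) := by
        simp only [exec, NatExpr.eval, h5₁, h6₁, hans]
      rw [hs₂]
      set s₂ := s₁.answer 10 12 0 (some (indicator D)) with hs₂'
      have h12 : s₂.arr 12 0 = indicator D := State.answer_some_arr _ _ _ _ _
      have hr2 : ∀ x, x ≠ 10 → s₂.reg x = s₁.reg x := fun x hx => by
        rw [hs₂', State.answer_reg, if_neg hx]
      have h8₂ : s₂.arr 8 = s₁.arr 8 := State.answer_arr_of_ne _ _ _ _ _ (by decide)
      have hrow : s₂.arr 12 0 (s₂.reg 3) ≠ 0 ↔ σ ∈ D := by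
        rw [h12, hr2 3 (by decide), h3₁]
        exact isRow_indicator D σ
      by_cases hσ : σ ∈ D
      · rw [exec_cond_pos (by simpa only [nonzero_holds, NatExpr.eval] using hrow.2 hσ), exec]
        refine iff_of_false (by simp [h8₂, h8₁]) ?_
        rintro ⟨D', h1, h2, h3, h4, h5, h6⟩
        exact h6 ((isLeast_residual_of_isCore hF h1 h2 h3 h4 h5).unique hleast ▸ hσ)
      · rw [exec_cond_neg (by
          simp only [nonzero_holds, NatExpr.eval]
          exact fun h => hσ (hrow.1 h)), exec]
        refine iff_of_true ?_ ⟨D, hD, haS, haD, hvT, hvD, hσ⟩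
        simp [State.setArr_arr, NatExpr.eval, hr2 5, hr2 6, h5₁, h6₁]
  · rw [← h e hi hj, exec_seq]
    have hne' : ¬ (i' = i ∧ j' = j) := fun h => hne (by rw [h.1, h.2])
    have hkey : ∀ s'' : State, s''.reg 5 = i → s''.reg 6 = j → ∀ z,
        ((setArr 8 (.reg 5) (.reg 6) z).exec O s'').arr 8 i' j' = s''.arr 8 i' j' :=
      fun s'' h5 h6 z => by simp [exec, NatExpr.eval, State.setArr_arr, h5, h6, hne']
    have hk₁ := hkey s' h5' h6' (.const 0)
    have hfr₁ : Frame _ s' _ := frame_exec O (setArr 8 (.reg 5) (.reg 6) (.const 0)) s'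
    set s₁ := (setArr 8 (.reg 5) (.reg 6) (.const 0)).exec O s'
    rw [← hk₁]
    by_cases hm : (nonzero (.arr 6 (.reg 5) (.reg 6))).Holds s₁
    · rw [exec_cond_pos hm, exec_seq]
      have hfr₂ := frame_exec O (query false 5 (.reg 5) (.reg 6) 10 12 (.const 0)) s₁
      set s₂ := (query false 5 (.reg 5) (.reg 6) 10 12 (.const 0)).exec O s₁
      rw [← hfr₂.arr 8 (by decide)]
      by_cases hm' : (nonzero (.arr 12 (.const 0) (.reg 3))).Holds s₂
      · rw [exec_cond_pos hm', exec]
      · rw [exec_cond_neg hm', hkey]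
        · rw [hfr₂.reg 5 (by decide), hfr₁.reg 5 (by decide), h5']
        · rw [hfr₂.reg 6 (by decide), hfr₁.reg 6 (by decide), h6']
    · rw [exec_cond_neg hm, exec]

open Classical in
theorem exec_coverHalo (hF : IsSTCrossing S T F) (hP : IsProper S T F) {s : State}
    (hn : s.reg 0 = n) (hN : s.reg 1 = n * n) {J₀ : Finset (Fin n × Fin n)}
    (h5 : edgesOf n (s.arr 5) = J₀) (h6 : MarksCores S T (uncovered F J₀) (s.arr 6))
    (hJ : J₀ ⊆ edgesOf n (s.arr 2)) (hE : IsEdgeCover (edgesOf n (s.arr 1)) F)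
    (hEST : edgesOf n (s.arr 1) ⊆ S ×ˢ T)
    (hc : ∀ e ∈ edgesOf n (s.arr 1), 0 ≤ costsOf n (s.costArr 0) e)
    {C : Finset (Fin n)} (hC : IsCore (uncovered F J₀) C) {σ v : Fin n} (hσ : s.reg 3 = σ)
    (hv : s.reg 4 = v) (hσS : σ ∈ S) (hσC : σ ∈ C) (hvT : v ∈ T) (hvC : v ∉ C)
    {J' : Finset (Fin n × Fin n)}
    (hJ' : J' = edgesOf n ((coverHalo.exec (familyOracle S T F) s).arr 2)) :
    edgesOf n (s.arr 2) ⊆ J' ∧ J' \ edgesOf n (s.arr 2) ⊆ edgesOf n (s.arr 1) ∧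
      IsEdgeCover J' (halo (uncovered F J₀) C) ∧
      ∀ x, IsFractionalCover (edgesOf n (s.arr 1)) (halo (uncovered F J₀) C) x →
        ∑ e ∈ J' \ edgesOf n (s.arr 2), costsOf n (s.costArr 0) e ≤
          ∑ e ∈ edgesOf n (s.arr 1) with
            ∃ X ∈ uncovered (halo (uncovered F J₀) C) (edgesOf n (s.arr 2)), Covers e X,
            costsOf n (s.costArr 0) e * x e := by
  set O := familyOracle S T F with hO
  rw [coverHalo, exec_seq, exec_seq, exec_seq] at hJ'
  have hleast := isLeast_residual_of_isCore hF hC hσS hσC hvT hvC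
  have hans : O false (s.arr 5) σ v = some (indicator C) := by
    rcases oracle_least hF (s.arr 5) σ v with ⟨D', hD', h⟩ | ⟨h, -⟩
    · rw [h5] at hD'
      rw [hO, h, hD'.unique hleast]
    · rw [h5] at h
      exact (Set.eq_empty_iff_forall_notMem.1 h C hleast.1).elim
  have hfr₁ := frame_exec O (query false 5 (.reg 3) (.reg 4) 10 7 (.const 0)) s
  have hs₁ : (query false 5 (.reg 3) (.reg 4) 10 7 (.const 0)).exec O s =
      s.answer 10 7 0 (some (indicator C)) := by
    simp only [exec, NatExpr.eval, hσ, hv, hans]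
  have h7₁ : ((query false 5 (.reg 3) (.reg 4) 10 7 (.const 0)).exec O s).arr 7 0 =
      indicator C := by rw [hs₁, State.answer_some_arr]
  set s₁ := (query false 5 (.reg 3) (.reg 4) 10 7 (.const 0)).exec O s
  have hB := exec_markForbidden hF (s := s₁) ((hfr₁.reg 0 (by decide)).trans hn)
    (by rw [hfr₁.arr 5 (by decide), h5]) (by rwa [hfr₁.arr 6 (by decide)])
    ((hfr₁.reg 3 (by decide)).trans hσ)
  rw [← hO] at hB
  have hfr₂ := frame_exec O markForbidden s₁
  set s₂ := markForbidden.exec O s₁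
  have hcopy := exec_copyCosts (O := O) (s := s₂) (a := 0) (b := 1) (n := n)
    (by rw [hfr₂.reg 0 (by decide), hfr₁.reg 0 (by decide), hn]) (by decide)
  have hfr₃ := frame_exec O (copyCosts 0 1) s₂
  set s₃ := (copyCosts 0 1).exec O s₂
  have h2 : s₃.arr 2 = s.arr 2 := by
    rw [hfr₃.arr 2 (by decide), hfr₂.arr 2 (by decide), hfr₁.arr 2 (by decide)]
  have h1 : s₃.arr 1 = s.arr 1 := by
    rw [hfr₃.arr 1 (by decide), hfr₂.arr 1 (by decide), hfr₁.arr 1 (by decide)]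
  -- Every halo starts again from the original costs; duals are not carried over from one halo to
  -- the next.
  have hcosts : costsOf n (s₃.costArr 1) = costsOf n (s.costArr 0) := funext fun e => by
    rw [costsOf, hcopy, hfr₂.costArr 0 (by decide), hfr₁.costArr 0 (by decide), costsOf]
  have hmem : HaloMemory C (edgesOf n (s₂.arr 8)) σ s₃ :=
    ⟨by rw [hfr₃.reg 0 (by decide), hfr₂.reg 0 (by decide), hfr₁.reg 0 (by decide), hn],
      by rw [hfr₃.reg 3 (by decide), hfr₂.reg 3 (by decide), hfr₁.reg 3 (by decide), hσ],
      by
        rw [hfr₃.arr 7 (by decide), hfr₂.arr 7 (by decide), h7₁]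
        exact isRow_indicator C,
      by rw [hfr₃.arr 8 (by decide)]⟩
  have hctx : HaloContext S T F (halo (uncovered F J₀) C) C J₀ (edgesOf n (s₂.arr 8)) σ :=
    ⟨fun J hJ v hv hvC => residual_union_eq_halo hF hP hJ hC hσS hσC hv hvC fun e => by
        rw [Finset.mem_filter, hB]
        constructor
        · rintro ⟨⟨D, h1, h2, h3, -, h4, h5⟩, rfl⟩
          exact ⟨rfl, D, h1, h2, h3, h4, h5⟩
        · rintro ⟨rfl, D, h1, h2, h3, h4, h5⟩
          exact ⟨⟨D, h1, h2, h3, hv, h4, h5⟩, rfl⟩,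
      fun X hX => hX.2.1, fun X hX => (hP X hX.1.1).2⟩
  have := exec_primal_dual hF hctx
    (fun X hX Y hY t ht htX htY =>
      halo_inter_mem (hF.uncovered J₀) (hP.uncovered J₀) hC.1 hX hY ht htX htY) hmem
    (by rw [hfr₃.reg 1 (by decide), hfr₂.reg 1 (by decide), hfr₁.reg 1 (by decide), hN])
    (by rwa [h2]) (by
      rw [h1]
      exact hE.anti fun X hX => hX.1.1)
    (fun e he => (Finset.mem_product.1 (hEST (h1 ▸ he))).2) (by rwa [h1, hcosts]) hJ'
  rwa [h1, h2, hcosts] at this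

/-- The criterion of `isCore_iff_of_isLeast` is tested: an entry starts at `1` and is cleared once
some node of the reported set has a least member omitting the source. -/
theorem exec_markCores (hF : IsSTCrossing S T F) (hP : IsProper S T F) {s : State}
    (hn : s.reg 0 = n) {J₀ : Finset (Fin n × Fin n)} (h5 : edgesOf n (s.arr 5) = J₀) :
    MarksCores S T (uncovered F J₀) ((markCores.exec (familyOracle S T F) s).arr 6) := by
  set O := familyOracle S T F with hO
  intro a v
  refine (exec_forTo_forall₂ (O := O) (x := 3) (y := 4) (s := s) (fun _ => True)
    (fun i j s' => ∀ a v : Fin n, a = i → v = j → (s'.arr 6 i j ≠ 0 ↔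
      ∃ D, IsCore (uncovered F J₀) D ∧ a ∈ S ∧ a ∈ D ∧ v ∈ T ∧ v ∉ D)) hn
    (by decide) (by decide) (fun _ _ => ⟨id, id⟩) (fun _ _ _ _ => ⟨id, id⟩) trivial
    ?_).2 a a.2 v v.2 a v rfl rfl
  intro i hi j hj s' h3 h4 hfr _
  have hkey : ∀ s'' : State, s''.reg 3 = i → s''.reg 4 = j → ∀ z i' j',
      ((setArr 6 (.reg 3) (.reg 4) z).exec O s'').arr 6 i' j' =
        if i' = i ∧ j' = j then z.eval s'' else s''.arr 6 i' j' :=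
    fun s'' h3 h4 z i' j' => by simp [exec, NatExpr.eval, State.setArr_arr, h3, h4]
  rw [exec_seq, exec_seq]
  have hk₁ := hkey s' h3 h4 (.const 0)
  have hfr₁ := frame_exec O (setArr 6 (.reg 3) (.reg 4) (.const 0)) s'
  set s₁ := (setArr 6 (.reg 3) (.reg 4) (.const 0)).exec O s'
  have h3₁ : s₁.reg 3 = i := by rw [hfr₁.reg 3 (by decide), h3]
  have h4₁ : s₁.reg 4 = j := by rw [hfr₁.reg 4 (by decide), h4]
  have h5₁ : edgesOf n (s₁.arr 5) = J₀ := by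
    rw [hfr₁.arr 5 (by decide), hfr.arr 5 (by decide), h5]
  have hs₂ : (query false 5 (.reg 3) (.reg 4) 10 12 (.const 0)).exec O s₁ =
      s₁.answer 10 12 0 (O false (s₁.arr 5) i j) := by
    simp only [exec, NatExpr.eval, h3₁, h4₁]
  have hfr₂ := frame_exec O (query false 5 (.reg 3) (.reg 4) 10 12 (.const 0)) s₁
  set s₂ := (query false 5 (.reg 3) (.reg 4) 10 12 (.const 0)).exec O s₁
  have h3₂ : s₂.reg 3 = i := by rw [hfr₂.reg 3 (by decide), h3₁]
  have h4₂ : s₂.reg 4 = j := by rw [hfr₂.reg 4 (by decide), h4₁]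
  have h5₂ : edgesOf n (s₂.arr 5) = J₀ := by rw [hfr₂.arr 5 (by decide), h5₁]
  have hn₂ : s₂.reg 0 = n := by
    rw [hfr₂.reg 0 (by decide), hfr₁.reg 0 (by decide), hfr.reg 0 (by decide), hn]
  obtain ⟨a, rfl⟩ : ∃ a : Fin n, (a : ℕ) = i := ⟨⟨i, hi⟩, rfl⟩
  obtain ⟨v, rfl⟩ : ∃ v : Fin n, (v : ℕ) = j := ⟨⟨j, hj⟩, rfl⟩
  have hgoal : ∀ t : State, (t.arr 6 a v ≠ 0 ↔
        ∃ D, IsCore (uncovered F J₀) D ∧ a ∈ S ∧ a ∈ D ∧ v ∈ T ∧ v ∉ D) →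
      (∀ i' j' : ℕ, ¬ (i' = a ∧ j' = v) → t.arr 6 i' j' = s'.arr 6 i' j') →
      True ∧ (∀ a' v' : Fin n, (a' : ℕ) = a → (v' : ℕ) = v → (t.arr 6 a v ≠ 0 ↔
        ∃ D, IsCore (uncovered F J₀) D ∧ a' ∈ S ∧ a' ∈ D ∧ v' ∈ T ∧ v' ∉ D)) ∧
      ∀ i' j' : ℕ, (∀ a v : Fin n, a = i' → v = j' → (s'.arr 6 i' j' ≠ 0 ↔
        ∃ D, IsCore (uncovered F J₀) D ∧ a ∈ S ∧ a ∈ D ∧ v ∈ T ∧ v ∉ D)) →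
        (i', j') ≠ ((a : ℕ), (v : ℕ)) → ∀ a v : Fin n, a = i' → v = j' → (t.arr 6 i' j' ≠ 0 ↔
        ∃ D, IsCore (uncovered F J₀) D ∧ a ∈ S ∧ a ∈ D ∧ v ∈ T ∧ v ∉ D) := by
    intro t h1 h2
    refine ⟨trivial, fun a' v' ha hv => ?_, fun i' j' h hne => ?_⟩
    · rwa [Fin.ext ha, Fin.ext hv]
    · rwa [h2 i' j' fun h => hne (by rw [h.1, h.2])]
  rcases oracle_least hF (s₁.arr 5) a v with ⟨C, hC, hans⟩ | ⟨hemp, hans⟩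
  · rw [hO, hans] at hs₂
    rw [h5₁] at hC
    have h10 : s₂.reg 10 = 1 := by simp [hs₂, State.answer_reg]
    have h12 : s₂.arr 12 0 = indicator C := by rw [hs₂, State.answer_some_arr]
    rw [exec_cond_pos (by simp [nonzero_holds, NatExpr.eval, h10]), exec_seq]
    have hk₃ := hkey s₂ h3₂ h4₂ (.const 1)
    have hfr₃ := frame_exec O (setArr 6 (.reg 3) (.reg 4) (.const 1)) s₂
    set s₃ := (setArr 6 (.reg 3) (.reg 4) (.const 1)).exec O s₂
    have hloop := exec_forTo_induct (O := O) (x := 7) (r := 0) (s := s₃)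
      (c := cond (nonzero (.arr 12 (.const 0) (.reg 7)))
          (seq (query false 5 (.reg 7) (.reg 4) 10 13 (.const 0))
            (cond (.and (nonzero (.reg 10)) (.neg (nonzero (.arr 13 (.const 0) (.reg 3)))))
              (setArr 6 (.reg 3) (.reg 4) (.const 0)) skip)) skip)
      (fun k s' => (s'.arr 6 a v ≠ 0 ↔ ∀ b : Fin n, b < k → b ∈ C → ∀ D,
          IsLeast (residual S T F J₀ b v) D → a ∈ D) ∧
        ∀ i' j' : ℕ, ¬ (i' = a ∧ j' = v) → s'.arr 6 i' j' = s₃.arr 6 i' j')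
      ((hfr₃.reg 0 (by decide)).trans hn₂) ⟨by simp [hk₃, NatExpr.eval], fun _ _ _ => rfl⟩ (by
        rintro k hk t h7 hfr' ⟨hI, hI'⟩
        obtain ⟨b, rfl⟩ : ∃ b : Fin n, (b : ℕ) = k := ⟨⟨k, hk⟩, rfl⟩
        have hlt : ∀ w : Fin n, (w : ℕ) < b + 1 → w < b ∨ w = b := fun w hw => by
          rw [Fin.lt_def, Fin.ext_iff]
          omega
        have h12t : t.arr 12 0 = indicator C := by
          rw [hfr'.arr 12 (by decide), hfr₃.arr 12 (by decide), h12]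
        have h5t : edgesOf n (t.arr 5) = J₀ := by
          rw [hfr'.arr 5 (by decide), hfr₃.arr 5 (by decide), h5₂]
        have h3t : t.reg 3 = a := by rw [hfr'.reg 3 (by decide), hfr₃.reg 3 (by decide), h3₂]
        have h4t : t.reg 4 = v := by rw [hfr'.reg 4 (by decide), hfr₃.reg 4 (by decide), h4₂]
        have hsame : (b ∈ C → ∀ D, IsLeast (residual S T F J₀ b v) D → a ∈ D) →
            (t.arr 6 a v ≠ 0 ↔ ∀ c : Fin n, (c : ℕ) < b + 1 → c ∈ C → ∀ D,
              IsLeast (residual S T F J₀ c v) D → a ∈ D) := fun hb => by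
          rw [hI]
          refine ⟨fun h c hc => ?_, fun h c hc => h c (by omega)⟩
          rcases hlt c hc with hc | rfl
          · exact h c hc
          · exact hb
        by_cases hbC : b ∈ C
        · have hrow : indicator C b ≠ 0 := (isRow_indicator C b).2 hbC
          rw [exec_cond_pos (by simpa [nonzero_holds, NatExpr.eval, h7, h12t] using hrow), exec_seq]
          have hq : (query false 5 (.reg 7) (.reg 4) 10 13 (.const 0)).exec O t =
              t.answer 10 13 0 (O false (t.arr 5) b v) := by
            simp only [exec, NatExpr.eval, h7, h4t]
          have hfrq := frame_exec O (query false 5 (.reg 7) (.reg 4) 10 13 (.const 0)) t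
          set t' := (query false 5 (.reg 7) (.reg 4) 10 13 (.const 0)).exec O t
          have h6t' : t'.arr 6 = t.arr 6 := hfrq.arr 6 (by decide)
          have h3t' : t'.reg 3 = a := (hfrq.reg 3 (by decide)).trans h3t
          have h4t' : t'.reg 4 = v := (hfrq.reg 4 (by decide)).trans h4t
          rcases oracle_least hF (t.arr 5) b v with ⟨D, hD, hansD⟩ | ⟨hempD, hansD⟩
          · rw [hO, hansD] at hq
            rw [h5t] at hD
            have h10' : t'.reg 10 = 1 := by simp [hq, State.answer_reg]
            have h13' : t'.arr 13 0 = indicator D := by rw [hq, State.answer_some_arr]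
            have hrowD : indicator D a ≠ 0 ↔ a ∈ D := isRow_indicator D a
            by_cases haD : a ∈ D
            · rw [exec_cond_neg (by
                simpa [Test.Holds, nonzero_holds, NatExpr.eval, h10', h13', h3t'] using
                  hrowD.2 haD), exec, State.setReg_arr, h6t']
              exact ⟨hsame fun _ D' hD' => hD'.unique hD ▸ haD, hI'⟩
            · rw [exec_cond_pos (by
                simp only [Test.Holds, nonzero_holds, NatExpr.eval, h10', h13', h3t', hrowD]
                exact ⟨one_ne_zero, haD⟩), State.setReg_arr]
              have hk' := hkey t' h3t' h4t' (.const 0)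
              refine ⟨?_, fun i' j' hne => ?_⟩
              · rw [hk', if_pos ⟨rfl, rfl⟩]
                simp only [NatExpr.eval, ne_eq, not_true_eq_false, false_iff]
                exact fun h => haD (h b (by omega) hbC D hD)
              · rw [hk', if_neg hne, h6t', hI' i' j' hne]
          · rw [hO, hansD] at hq
            rw [h5t] at hempD
            have h10' : t'.reg 10 = 0 := by simp [hq, State.answer_reg]
            -- Without an answer, array `13` may hold an outdated row; the test of variable `10`
            -- prevents its use, and the criterion is vacuous for this node.
            rw [exec_cond_neg (by
                simp [Test.Holds, nonzero_holds, NatExpr.eval, h10']), exec, State.setReg_arr, h6t']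
            exact ⟨hsame fun _ D' hD' =>
              (Set.eq_empty_iff_forall_notMem.1 hempD D' hD'.1).elim, hI'⟩
        · have hrow : indicator C b = 0 := by
            by_contra h
            exact hbC ((isRow_indicator C b).1 h)
          rw [exec_cond_neg (by simpa [nonzero_holds, NatExpr.eval, h7, h12t] using hrow), exec,
            State.setReg_arr]
          exact ⟨hsame fun h => (hbC h).elim, hI'⟩)
    refine hgoal _ (hloop.1.trans ?_) fun i' j' hne => ?_
    · obtain ⟨-, haS, haC, hvT, hvC⟩ := mem_residual.1 hC.1
      have hcore := isCore_iff_of_isLeast hF hP hC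
      constructor
      · intro h
        exact ⟨C, hcore.2 fun b hb => h b b.2 hb, haS, haC, hvT, hvC⟩
      · rintro ⟨D, hD, -, haD, -, hvD⟩
        obtain rfl := hC.unique (isLeast_residual_of_isCore hF hD haS haD hvT hvD)
        exact fun b _ hb => hcore.1 hD b hb
    · rw [hloop.2 i' j' hne, hk₃, if_neg hne, hfr₂.arr 6 (by decide), hk₁, if_neg hne]
  · rw [hO, hans] at hs₂
    rw [h5₁] at hemp
    have h10 : s₂.reg 10 = 0 := by simp [hs₂, State.answer_reg]
    rw [exec_cond_neg (by simp [nonzero_holds, NatExpr.eval, h10]), exec]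
    refine hgoal _ ?_ fun i' j' hne => ?_
    · rw [hfr₂.arr 6 (by decide), hk₁, if_pos ⟨rfl, rfl⟩]
      simp only [NatExpr.eval, ne_eq, not_true_eq_false, false_iff]
      rintro ⟨D, hD, haS, haD, hvT, hvD⟩
      exact Set.eq_empty_iff_forall_notMem.1 hemp D
        (isLeast_residual_of_isCore hF hD haS haD hvT hvD).1
    · rw [hfr₂.arr 6 (by decide), hk₁, if_neg hne]

/-- Array `5` freezes the edge set at the start of the phase, so cores and halos keep referring to
it while array `2` grows. Properness provides a marked pair for every core, so no halo is missed. -/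
theorem exec_phase (hF : IsSTCrossing S T F) (hP : IsProper S T F) {s : State}
    (hn : s.reg 0 = n) (hN : s.reg 1 = n * n) {E J J' : Finset (Fin n × Fin n)}
    {c : Fin n × Fin n → ℝ} (h1 : edgesOf n (s.arr 1) = E) (hcE : costsOf n (s.costArr 0) = c)
    (hE : IsEdgeCover E F) (hEST : E ⊆ S ×ˢ T) (hc : ∀ e ∈ E, 0 ≤ c e)
    (hJ : edgesOf n (s.arr 2) = J)
    (hJ' : J' = edgesOf n ((phase.exec (familyOracle S T F) s).arr 2)) :
    IsPhase E c F J J' ∧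
      ∀ C, IsCore (uncovered F J) C → IsEdgeCover J' (halo (uncovered F J) C) := by
  set O := familyOracle S T F with hO
  rw [phase, exec_seq, exec_seq] at hJ'
  have hcopy := (exec_forTo_forall₂ (O := O) (x := 3) (y := 4) (s := s)
    (c := setArr 5 (.reg 3) (.reg 4) (.arr 2 (.reg 3) (.reg 4))) (fun _ => True)
    (fun i j s' => s'.arr 5 i j = s.arr 2 i j) hn (by decide) (by decide)
    (fun _ _ => ⟨id, id⟩) (fun _ _ _ _ => ⟨id, id⟩) trivial (by
      intro i _ j _ s' h3 h4 hfr _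
      have h2 := hfr.arr 2 (by decide)
      refine ⟨trivial, ?_, fun i' j' h hne => ?_⟩
      · simp [exec, NatExpr.eval, State.setArr_arr, h3, h4, h2]
      · simp only [exec, NatExpr.eval, State.setArr_arr, h3, h4]
        rw [if_neg (fun h => hne (by rw [h.2.1, h.2.2]))]
        exact h)).2
  have hfr₁ := frame_exec O (forPairs 3 4 (setArr 5 (.reg 3) (.reg 4) (.arr 2 (.reg 3) (.reg 4)))) s
  set s₁ := (forPairs 3 4 (setArr 5 (.reg 3) (.reg 4) (.arr 2 (.reg 3) (.reg 4)))).exec O s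
  have h5₁ : edgesOf n (s₁.arr 5) = J := by
    rw [← hJ]
    ext e
    rw [mem_edgesOf, mem_edgesOf, hcopy e.1 e.1.2 e.2 e.2.2]
  have hmark := exec_markCores hF hP ((hfr₁.reg 0 (by decide)).trans hn) h5₁
  rw [← hO] at hmark
  have hfr₂ := frame_exec O markCores s₁
  set s₂ := markCores.exec O s₁
  have h2₂ : edgesOf n (s₂.arr 2) = J := by
    rw [hfr₂.arr 2 (by decide), hfr₁.arr 2 (by decide), hJ]
  have hmain := exec_forTo_forall₂ (O := O) (x := 3) (y := 4) (s := s₂)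
    (c := cond (nonzero (.arr 6 (.reg 3) (.reg 4))) coverHalo skip)
    (fun s' => IsPhase E c F J (edgesOf n (s'.arr 2)))
    (fun i j s' => ∀ a v : Fin n, a = i → v = j → ∀ C, IsCore (uncovered F J) C →
      a ∈ S → a ∈ C → v ∈ T → v ∉ C →
        IsEdgeCover (edgesOf n (s'.arr 2)) (halo (uncovered F J) C))
    (by rw [hfr₂.reg 0 (by decide), hfr₁.reg 0 (by decide), hn])
    (by decide) (by decide) (fun _ _ => ⟨id, id⟩) (fun _ _ _ _ => ⟨id, id⟩)
    (by
      rw [h2₂]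
      exact isPhase_refl hc) (by
      intro i hi j hj s' h3 h4 hfr hI
      obtain ⟨a, rfl⟩ : ∃ a : Fin n, (a : ℕ) = i := ⟨⟨i, hi⟩, rfl⟩
      obtain ⟨v, rfl⟩ : ∃ v : Fin n, (v : ℕ) = j := ⟨⟨j, hj⟩, rfl⟩
      have h6 : s'.arr 6 = s₂.arr 6 := hfr.arr 6 (by decide)
      by_cases hm : s₂.arr 6 a v = 0
      · rw [exec_cond_neg (by simp [nonzero_holds, NatExpr.eval, h3, h4, h6, hm]), exec]
        refine ⟨hI, fun a' v' ha hv C hC haS haC hvT hvC => ?_, fun i' j' h _ => h⟩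
        rw [Fin.ext ha] at haS haC
        rw [Fin.ext hv] at hvT hvC
        exact ((hmark a v).2 ⟨C, hC, haS, haC, hvT, hvC⟩ hm).elim
      · obtain ⟨C, hC, haS, haC, hvT, hvC⟩ := (hmark a v).1 hm
        rw [exec_cond_pos (by simpa [nonzero_holds, NatExpr.eval, h3, h4, h6] using hm)]
        have h1' : edgesOf n (s'.arr 1) = E := by
          rw [hfr.arr 1 (by decide), hfr₂.arr 1 (by decide), hfr₁.arr 1 (by decide), h1]
        have hc' : costsOf n (s'.costArr 0) = c := by
          rw [hfr.costArr 0 (by decide), hfr₂.costArr 0 (by decide), hfr₁.costArr 0 (by decide),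
            hcE]
        have hres := exec_coverHalo hF hP (s := s')
          (by rw [hfr.reg 0 (by decide), hfr₂.reg 0 (by decide), hfr₁.reg 0 (by decide), hn])
          (by rw [hfr.reg 1 (by decide), hfr₂.reg 1 (by decide), hfr₁.reg 1 (by decide), hN])
          (by rw [hfr.arr 5 (by decide), hfr₂.arr 5 (by decide), h5₁]) (h6 ▸ hmark) hI.subset
          (h1' ▸ hE) (h1' ▸ hEST) (by rwa [h1', hc']) hC h3 h4 haS haC hvT hvC rfl
        rw [h1', hc', ← hO] at hres
        obtain ⟨hsub, hsubE, hcov, hcost⟩ := hres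
        refine ⟨hI.step hF hEST hc hC hsub hsubE hcov hcost,
          fun a' v' ha hv D hD haS' haD hvT' hvD => ?_,
          fun i' j' h _ a' v' ha hv D hD haS' haD hvT' hvD =>
            (h a' v' ha hv D hD haS' haD hvT' hvD).mono hsub⟩
        rw [Fin.ext ha] at haS' haD
        rw [Fin.ext hv] at hvT' hvD
        -- A pair of nodes determines its core, so covering the halo of `C` settles this pair.
        rwa [hD.eq_of_mem (hF.uncovered J) hC haS haD haC hvT hvD hvC])
  rw [hJ']
  refine ⟨hmain.1, fun C hC => ?_⟩
  obtain ⟨⟨a, haS, haC⟩, v, hvT, hvC⟩ := hP C hC.1.1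
  exact hmain.2 a a.2 v v.2 a v rfl rfl C hC haS haC hvT hvC

theorem exec_main (hF : IsSTCrossing S T F) {s : State}
    (hn : s.reg 0 = n) (hN : s.reg 1 = n * n) {E : Finset (Fin n × Fin n)}
    {c : Fin n × Fin n → ℝ} (h1 : edgesOf n (s.arr 1) = E) (hcE : costsOf n (s.costArr 0) = c)
    (hE : IsEdgeCover E F) (hEST : E ⊆ S ×ˢ T) (hc : ∀ e ∈ E, 0 ≤ c e)
    (hJ : edgesOf n (s.arr 2) = ∅) :
    IsProgress T E c F n (edgesOf n ((main.exec (familyOracle S T F) s).arr 2)) := by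
  have hP : IsProper S T F := hE.isProper hEST
  refine exec_forTo_induct (fun k s' => IsProgress T E c F k (edgesOf n (s'.arr 2))) hn
    (by
      rw [State.setReg_arr, hJ]
      exact isProgress_zero hF hP) ?_
  intro k _ s' _ hfr hI
  obtain ⟨h2, h3⟩ := exec_phase hF hP ((hfr.reg 0 (by decide)).trans hn)
    ((hfr.reg 1 (by decide)).trans hN) ((congrArg _ (hfr.arr 1 (by decide))).trans h1)
    ((congrArg _ (hfr.costArr 0 (by decide))).trans hcE) hE hEST hc rfl rfl
  exact hI.step hF hP hc h2 h3

theorem exec_square {O : Oracle} {s : State} (hn : s.reg 0 = n) :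
    (square.exec O s).reg 1 = n * n := by
  refine exec_forTo_induct (fun k s' => s'.reg 1 = k * n) (by simpa [exec] using hn)
    (by simp [exec, NatExpr.eval]) ?_
  intro k _ s' _ hfr h
  have h0 : s'.reg 0 = n := by
    rw [hfr.reg 0 (by decide)]
    simpa [exec] using hn
  simp [exec, NatExpr.eval, h, h0, Nat.add_mul]

end

end EdgeCover

end

theorem mainTheorem5 :
    ∃ (P : EdgeCover.Program) (p : Polynomial ℕ) (K : ℝ),
      ∀ (n : ℕ) (S T : Finset (Fin n)) (E : Finset (Fin n × Fin n))
        (c : Fin n × Fin n → ℝ) (F : Set (Finset (Fin n))),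
        S ∪ T = Finset.univ →
        E ⊆ S ×ˢ T →
        (∀ e ∈ E, 0 ≤ c e) →
        EdgeCover.IsSTCrossing S T F →
        ∃ (t : ℕ) (s : EdgeCover.State),
          EdgeCover.Runs (EdgeCover.familyOracle S T F) P
            (EdgeCover.initialState S T E c) t s ∧
          t ≤ p.eval n ∧
          (EdgeCover.IsEdgeCover E F →
            EdgeCover.output n s ⊆ E ∧
            EdgeCover.IsEdgeCover (EdgeCover.output n s) F ∧
            ∑ e ∈ EdgeCover.output n s, c e ≤
              K * Real.log ((S ∪ T).card : ℝ) * EdgeCover.lpValue E c F) := by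
  open EdgeCover EdgeCover.Cmd in
  refine ⟨.seq square.compile main.compile,
    -- In the second part the loop bounds are `n` and `n * n`, both at most `n + n * n`.
    square.time + main.time.comp (Polynomial.X + Polynomial.X * Polynomial.X), 2 / Real.log 2, ?_⟩
  intro n S T E c F hST hE hc hF
  set O := familyOracle S T F with hO
  set s₀ := initialState S T E c with hs₀
  have hfr := frame_exec O square s₀
  have hn : (square.exec O s₀).reg 0 = n := by
    rw [hfr.reg 0 (by decide)]
    simp [hs₀, initialState]
  have hN : (square.exec O s₀).reg 1 = n * n := exec_square (by simp [hs₀, initialState])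
  obtain ⟨t₁, ht₁, hr₁⟩ := runs_exec O (R := [0]) (B := n) (c := square) rfl s₀
    (by simp [hs₀, initialState])
  obtain ⟨t₂, ht₂, hr₂⟩ := runs_exec O (R := [0, 1]) (B := n + n * n) (c := main) rfl
    (square.exec O s₀) (by simp [hn, hN])
  refine ⟨t₁ + t₂, _, .seq hr₁ hr₂, ?_, fun hcov => ?_⟩
  · simp only [Polynomial.eval_add, Polynomial.eval_comp, Polynomial.eval_mul, Polynomial.eval_X]
    omega
  · have hE₁ : edgesOf n ((square.exec O s₀).arr 1) = E := by
      rw [hfr.arr 1 (by decide)]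
      ext e
      simp [mem_edgesOf, hs₀, initialState]
    -- The memory holds the costs only on `E` and zero elsewhere, so the two cost functions agree
    -- merely on `E`; this is enough for the LP value and for the output, which is contained in `E`.
    have hcE : ∀ e ∈ E, costsOf n ((square.exec O s₀).costArr 0) e = c e := fun e he => by
      rw [hfr.costArr 0 (by decide)]
      simp [costsOf, hs₀, initialState, he]
    have hemp : edgesOf n ((square.exec O s₀).arr 2) = ∅ := by
      rw [hfr.arr 2 (by decide)]
      simp [edgesOf, hs₀, initialState]
    have hprog := exec_main hF hn hN hE₁ rfl hcov hE (fun e he => hcE e he ▸ hc e he) hemp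
    have hP : IsProper S T F := hcov.isProper hE
    refine ⟨hprog.1, hprog.isEdgeCover hP, ?_⟩
    have hcost := hprog.cost_le hP hcov (fun e he => hcE e he ▸ hc e he)
    have hlp : lpValue E (costsOf n ((square.exec O s₀).costArr 0)) F = lpValue E c F := by
      unfold lpValue
      congr 1
      ext z
      refine exists_congr fun x => and_congr_right fun _ => ?_
      rw [Finset.sum_congr rfl fun e he => by rw [hcE e he]]
    rw [hlp, Finset.sum_congr rfl fun e he => hcE e (hprog.1 he)] at hcost
    rwa [hST, Finset.card_univ, Fintype.card_fin]
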